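/- **Setting.** There are $N$ agents, $M$ channels and time slots $t=0,1,2,\dots$. Agent $n$ has a status process $X_{n,t}$ with values in a finite set $\mathcal X_n$ and a safety level $Y_{n,t}$ with values in a finite set $\mathcal Y_n$. The status processes of different agents are independent; moreover, for all $n$ and $t$, the pair consisting of the process $X_{n,\cdot}$ and of $Y_{n,t}$ is independent of the status processes of the other agents. In slot $t$ a scheduler chooses $\mu_n(t)\in\{0,1\}$ with $\sum_n\mu_n(t)\le M$. The delivery indicators $\gamma_n(t)\in\{0,1\}$ are independent over agents and slots, with $P(\gamma_n(t)=1)=p_n$, and independent of all statuses and safety levels. The age of information starts from a given $\Delta_n(0)$ and satisfies $\Delta_n(t+1)=1$ if $\mu_n(t)=\gamma_n(t)=1$ and $\Delta_n(t+1)=\Delta_n(t)+1$ otherwise. (Statuses are defined at all integer times, since the packet available at time $0$ was generated at time $-\Delta_n(0)$; $\mu_n(-1)$ and $\gamma_n(-1)$ are given constants.) The history of agent $n$ is $$H_{n,t}=\big(X_{n,\tau-\Delta_n(\tau)},\Delta_n(\tau),\mu_n(\tau-1),\gamma_n(\tau-1)\big)_{\tau=0}^{t}.$$ Write $S_{n,t}=(\Delta_n(t),X_{n,t-\Delta_n(t)})$,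 $H_t=(H_{n,t})_{n=1}^N$, $S_t=(S_{n,t})_{n=1}^N$ and $\mu(t)=(\mu_n(t))_{n=1}^N$. A causal policy chooses $\mu(t)$, for each $t$, as a function of $H_t$ and possibly of an independent random number; a reduced policy chooses it, for each $t$, as a function of $S_t$ and possibly of an independent random number. Let $\Pi\supseteq\Pi_e$ be the sets of causal and of reduced policies. Estimators $\phi=(\phi_{n,t})$ assign an estimate $\phi_{n,t}(H_{n,t})\in\mathcal Y_n$ to each history; reduced estimators $f=(f_{n,t})$ assign an estimate $f_{n,t}(S_{n,t})\in\mathcal Y_n$. For loss functions $L_n:\mathcal Y_n\times\mathcal Y_n\to\mathbb R$ the joint scheduling–estimation problem is $$\mathsf L_{\rm opt}=\inf_{\pi\in\Pi,\ \phi}\ J(\pi,\phi),\qquad J(\pi,\phi)=\limsup_{T\to\infty}\sum_{n=1}^N\frac1T\sum_{t=0}^{T-1}\mathbb E\big[L_n(Y_{n,t},\phi_{n,t}(H_{n,t}))\big].$$ **Assumption 1.** For all $n$ and $t=0,1,2,\dots$, both $Y_{n,t}\leftrightarrow X_{n,t}\leftrightarrow X_{n,t-1}\leftrightarrow X_{n,t-2}\leftrightarrow\cdots$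 and $Y_{n,t}\leftrightarrow X_{n,t}\leftrightarrow X_{n,t+1}\leftrightarrow X_{n,t+2}\leftrightarrow\cdots$ are Markov chains. **Theorem 1.** If Assumption 1 holds, then: (i) Under every causal policy, for all $n$ and $t$, $S_{n,t}$ is a sufficient statistic of $H_{n,t}$ for estimating $Y_{n,t}$, that is, $P(Y_{n,t}=y\mid H_{n,t})=P(Y_{n,t}=y\mid S_{n,t})$ for all $y\in\mathcal Y_n$. (ii) $S_t$ is a sufficient statistic of $H_t$ for making the scheduling decision $\mu(t)$ in the joint problem, in the following sense. (a) There are kernels $K_{n,t}$ and $Q_t$, the same for all causal policies, such that for all $t$ and $n$ $$P(Y_{n,t}=y\mid H_t,\mu(t))=K_{n,t}(y\mid S_{n,t}),\qquad P(S_{t+1}=s'\mid H_t,\mu(t))=Q_t(s'\mid S_t,\mu(t)).$$ (b) For all loss functions nothing is lost by using only $S_t$. For every horizon $T$ there are a deterministic reduced policy and reduced estimators that minimize $\sum_{t=0}^{T-1}\sum_{n=1}^N\mathbb E[L_n(Y_{n,t},\phi_{n,t}(H_{n,t}))]$ over all causal policies and all estimators. For every $\pi\in\Pi$ and all estimators $\phi$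 there are $\rho\in\Pi_e$ and reduced estimators $f$ with $J(\rho,f)\le J(\pi,\phi)$; consequently $\mathsf L_{\rm opt}=\inf_{\rho\in\Pi_e,\ f}J(\rho,f)$. -/

import Mathlib

open MeasureTheory ProbabilityTheory Filter

/-- The chain `V ↔ W 0 ↔ W 1 ↔ W 2 ↔ ⋯` of discrete random variables is a Markov chain: for every
`k`, given `W k`, the next term `W (k + 1)` is conditionally independent of
`(V, W 0, …, W (k - 1))`. -/
def IsMarkovChainFrom {Ω A B : Type*} [MeasurableSpace Ω] (P : Measure Ω)
    (V : Ω → B) (W : ℕ → Ω → A) : Prop :=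
  ∀ (k : ℕ) (v : B) (w : ℕ → A),
    P.real {ω | V ω = v ∧ ∀ i ≤ k + 1, W i ω = w i} * P.real {ω | W k ω = w k} =
      P.real {ω | V ω = v ∧ ∀ i ≤ k, W i ω = w i} *
        P.real {ω | W k ω = w k ∧ W (k + 1) ω = w (k + 1)}

/-- The statistic `σ` of the discrete observation `H` is sufficient for estimating the discrete
random variable `V`: given `σ(H)`, `V` is conditionally independent of `H`, that is,
`P(V = v | H = h) = P(V = v | σ(H) = σ(h))` (written without division). -/
def IsSufficientStatistic {Ω A S B : Type*} [MeasurableSpace Ω] (P : Measure Ω)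
    (H : Ω → A) (σ : A → S) (V : Ω → B) : Prop :=
  ∀ (h : A) (v : B),
    P.real {ω | H ω = h ∧ V ω = v} * P.real {ω | σ (H ω) = σ h} =
      P.real {ω | H ω = h} * P.real {ω | σ (H ω) = σ h ∧ V ω = v}

/-- One entry of the history of an agent at time `τ`: the latest received status
`X_{τ - Δ(τ)}`, the age `Δ(τ)`, the previous decision `μ(τ - 1)` and the previous delivery
indicator `γ(τ - 1)`. -/
structure HistoryEntry (A : Type*) where
  packet : A
  age : ℕ
  pulled : Bool
  delivered : Bool

/-- Histories of one agent up to time `t`: one entry for each `τ = 0, …, t`. -/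
abbrev History (A : Type*) (t : ℕ) : Type _ := Fin (t + 1) → HistoryEntry A

/-- Joint histories of all agents up to time `t`. -/
abbrev JointHistory {N : ℕ} (𝒳 : Fin N → Type*) (t : ℕ) : Type _ := ∀ n, History (𝒳 n) t

/-- Tuples of pairs (age, latest received status), one for each agent. -/
abbrev JointState {N : ℕ} (𝒳 : Fin N → Type*) : Type _ := ∀ n, ℕ × 𝒳 n

/-- The statistic `(Δ(t), X_{t - Δ(t)})` of a history up to time `t`. -/
def History.state {A : Type*} {t : ℕ} (h : History A t) : ℕ × A :=
  ((h (Fin.last t)).age, (h (Fin.last t)).packet)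

/-- The tuple of the statistics of all agents. -/
def JointHistory.state {N : ℕ} {𝒳 : Fin N → Type*} {t : ℕ} (h : JointHistory 𝒳 t) :
    JointState 𝒳 :=
  fun n => History.state (h n)

/-- A (possibly randomized) scheduling policy for `N` agents and `M` channels, whose decision at
time `t` is a function of the information `i : I t` available at time `t` and of an independent
uniform random number. At most `M` agents are pulled in each slot. -/
structure Policy (N M : ℕ) (I : ℕ → Type*) where
  decide : (t : ℕ) → I t → unitInterval → Fin N → Bool
  measurable_decide : ∀ t i, Measurable (decide t i)
  feasible : ∀ t i u, (Finset.univ.filter fun n => decide t i u n = true).card ≤ M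

/-- The policy does not use its random number. -/
def Policy.IsDeterministic {N M : ℕ} {I : ℕ → Type*} (π : Policy N M I) : Prop :=
  ∀ t i u v, π.decide t i u = π.decide t i v

/-- Causal policies: decisions based on the joint history. -/
abbrev CausalPolicy (M : ℕ) {N : ℕ} (𝒳 : Fin N → Type*) : Type _ :=
  Policy N M (fun t => JointHistory 𝒳 t)

/-- Reduced policies: decisions based on the current ages and latest received statuses only. -/
abbrev ReducedPolicy (M : ℕ) {N : ℕ} (𝒳 : Fin N → Type*) : Type _ :=
  Policy N M (fun _ => JointState 𝒳)

/-- Every reduced policy is a causal policy. -/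
def Policy.toCausal {M N : ℕ} {𝒳 : Fin N → Type*} (π : ReducedPolicy M 𝒳) :
    CausalPolicy M 𝒳 where
  decide t h u := π.decide t (JointHistory.state h) u
  measurable_decide t h := π.measurable_decide t (JointHistory.state h)
  feasible t h u := π.feasible t (JointHistory.state h) u

/-- Families of estimators: agent `n` is estimated at time `t` from its own history. -/
abbrev Estimators {N : ℕ} (𝒳 𝒴 : Fin N → Type*) : Type _ :=
  (n : Fin N) → (t : ℕ) → History (𝒳 n) t → 𝒴 n

/-- Families of estimators that use only the age and the latest received status of the agent. -/
abbrev ReducedEstimators {N : ℕ} (𝒳 𝒴 : Fin N → Type*) : Type _ :=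
  (n : Fin N) → ℕ → ℕ × 𝒳 n → 𝒴 n

/-- A reduced estimator is an estimator. -/
def ReducedEstimators.toEstimators {N : ℕ} {𝒳 𝒴 : Fin N → Type*}
    (f : ReducedEstimators 𝒳 𝒴) : Estimators 𝒳 𝒴 :=
  fun n t h => f n t (History.state h)

/-- The random quantities and the initial data of a status-updating system with `N` agents.
Statuses are indexed by `ℤ` because the packet available at time `0` was generated at the time
`-Δ(0)`. -/
structure MonitoringSystem (N : ℕ) (𝒳 𝒴 : Fin N → Type*) (Ω : Type*) where
  /-- status of agent `n` at time `t` -/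
  X : (n : Fin N) → ℤ → Ω → 𝒳 n
  /-- safety level of agent `n` at time `t` -/
  Y : (n : Fin N) → ℕ → Ω → 𝒴 n
  /-- delivery indicators -/
  γ : Fin N → ℕ → Ω → Bool
  /-- the random number that a randomized policy may use in slot `t` -/
  U : ℕ → Ω → unitInterval
  /-- probabilities of a successful transmission -/
  p : Fin N → ℝ
  /-- initial ages `Δ(0)` -/
  initialAge : Fin N → ℕ
  /-- initial entries `μ(-1)` of the histories -/
  initialPulled : Fin N → Bool
  /-- initial entries `γ(-1)` of the histories -/
  initialDelivered : Fin N → Bool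

namespace MonitoringSystem

variable {N M : ℕ} {𝒳 𝒴 : Fin N → Type*} {Ω : Type*}

/-- The joint history `(H_{n,t})_n` that arises under the causal policy `π`. In slot `t` the policy
chooses the agents to pull; the age of agent `n` becomes `1` if it is pulled and its packet is
delivered, and otherwise grows by `1`. -/
def jointHistory (S : MonitoringSystem N 𝒳 𝒴 Ω) (π : CausalPolicy M 𝒳) (ω : Ω) :
    (t : ℕ) → JointHistory 𝒳 t
  | 0 => fun n _ =>
      { packet := S.X n (-(S.initialAge n : ℤ)) ω
        age := S.initialAge n
        pulled := S.initialPulled n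
        delivered := S.initialDelivered n }
  | t + 1 => fun n =>
      let h := jointHistory S π ω t
      let μ := π.decide t h (S.U t ω) n
      let age' := if μ = true ∧ S.γ n t ω = true then 1 else (h n (Fin.last t)).age + 1
      Fin.snoc (α := fun _ => HistoryEntry (𝒳 n)) (h n)
        { packet := S.X n (((t + 1 : ℕ) : ℤ) - (age' : ℤ)) ω
          age := age'
          pulled := μ
          delivered := S.γ n t ω }

/-- The scheduling decision `(μ_n(t))_n` under the policy `π`. -/
def decision (S : MonitoringSystem N 𝒳 𝒴 Ω) (π : CausalPolicy M 𝒳) (t : ℕ) (ω : Ω) :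
    Fin N → Bool :=
  π.decide t (S.jointHistory π ω t) (S.U t ω)

/-- The standing probabilistic assumptions: statuses of different agents are independent (and the
safety level of an agent does not depend on the statuses of other agents); the delivery indicators
are independent Bernoulli variables, independent of statuses and safety levels; the random numbers
for randomized decisions are i.i.d. uniform and independent of everything else. -/
structure IsModel [∀ n, MeasurableSpace (𝒳 n)] [∀ n, MeasurableSpace (𝒴 n)] [MeasurableSpace Ω]
    (S : MonitoringSystem N 𝒳 𝒴 Ω) (P : Measure Ω) : Prop where
  measurable_X : ∀ n s, Measurable (S.X n s)
  measurable_Y : ∀ n t, Measurable (S.Y n t)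
  measurable_γ : ∀ n t, Measurable (S.γ n t)
  measurable_U : ∀ t, Measurable (S.U t)
  indep_status : iIndepFun (fun n ω => fun s : ℤ => S.X n s ω) P
  indep_agent : ∀ n t, IndepFun (fun ω => ((fun s : ℤ => S.X n s ω), S.Y n t ω))
    (fun ω => fun (m : {m : Fin N // m ≠ n}) (s : ℤ) => S.X m s ω) P
  delivery_prob : ∀ n t, P.real {ω | S.γ n t ω = true} = S.p n
  indep_delivery : iIndepFun (fun (i : Fin N × ℕ) => S.γ i.1 i.2) P
  uniform_U : ∀ t, P.map (S.U t) = volume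
  indep_U : iIndepFun S.U P
  indep_delivery_U :
    IndepFun (fun ω => fun (n : Fin N) (t : ℕ) => S.γ n t ω) (fun ω => fun t => S.U t ω) P
  indep_source : IndepFun
    (fun ω => ((fun (n : Fin N) (s : ℤ) => S.X n s ω), (fun (n : Fin N) (t : ℕ) => S.Y n t ω)))
    (fun ω => ((fun (n : Fin N) (t : ℕ) => S.γ n t ω), (fun t => S.U t ω))) P

/-- For every agent and every time `t = 0, 1, 2, …`, both
`Y_t ↔ X_t ↔ X_{t-1} ↔ X_{t-2} ↔ ⋯` and `Y_t ↔ X_t ↔ X_{t+1} ↔ X_{t+2} ↔ ⋯` are Markov chains. -/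
def MarkovAssumption [MeasurableSpace Ω] (S : MonitoringSystem N 𝒳 𝒴 Ω) (P : Measure Ω) : Prop :=
  ∀ (n : Fin N) (t : ℕ),
    IsMarkovChainFrom P (S.Y n t) (fun i : ℕ => S.X n ((t : ℤ) - (i : ℤ))) ∧
    IsMarkovChainFrom P (S.Y n t) (fun i : ℕ => S.X n ((t : ℤ) + (i : ℤ)))

/-- The expected loss `𝔼[L_n(Y_{n,t}, φ_n(H_{n,t}))]` under the policy `π`. -/
noncomputable def expectedLoss [MeasurableSpace Ω] (S : MonitoringSystem N 𝒳 𝒴 Ω) (P : Measure Ω)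
    (L : (n : Fin N) → 𝒴 n → 𝒴 n → ℝ) (π : CausalPolicy M 𝒳) (φ : Estimators 𝒳 𝒴)
    (n : Fin N) (t : ℕ) : ℝ :=
  ∫ ω, L n (S.Y n t ω) (φ n t (S.jointHistory π ω t n)) ∂P

/-- The long-run time-average of the total expected loss. -/
noncomputable def averageLoss [MeasurableSpace Ω] (S : MonitoringSystem N 𝒳 𝒴 Ω) (P : Measure Ω)
    (L : (n : Fin N) → 𝒴 n → 𝒴 n → ℝ) (π : CausalPolicy M 𝒳) (φ : Estimators 𝒳 𝒴) : ℝ :=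
  limsup (fun T : ℕ => ∑ n, (1 / (T : ℝ)) * ∑ t ∈ Finset.range T, S.expectedLoss P L π φ n t) atTop

/-- The optimal value of the joint scheduling and estimation problem with `M` channels. -/
noncomputable def optimalLoss [MeasurableSpace Ω] (M : ℕ) (S : MonitoringSystem N 𝒳 𝒴 Ω)
    (P : Measure Ω) (L : (n : Fin N) → 𝒴 n → 𝒴 n → ℝ) : ℝ :=
  ⨅ q : CausalPolicy M 𝒳 × Estimators 𝒳 𝒴, S.averageLoss P L q.1 q.2

/-- The optimal value when decisions and estimates may use only the current ages and latest
received statuses. -/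
noncomputable def reducedOptimalLoss [MeasurableSpace Ω] (M : ℕ) (S : MonitoringSystem N 𝒳 𝒴 Ω)
    (P : Measure Ω) (L : (n : Fin N) → 𝒴 n → 𝒴 n → ℝ) : ℝ :=
  ⨅ q : ReducedPolicy M 𝒳 × ReducedEstimators 𝒳 𝒴,
    S.averageLoss P L q.1.toCausal q.2.toEstimators

end MonitoringSystem

/-!
The theorem rests on one factorization. Fix a sample point `ω₀`. The event that the joint history
up to time `t` equals its value at `ω₀` is an intersection of three events: the statuses of each
agent at the generation times of the packets received so far are the recorded ones, the past
delivery indicators are the recorded ones, and the past random numbers lead the policy to the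
recorded decisions (`jointHistory_eq_iff`). The three are independent, the first splits over the
agents, and, once the history is fixed, only the last involves the policy. The current random
number, which then fixes the current decision, and the current delivery indicators are independent
of all this.

The generation times do not decrease and do not exceed `t`, so the event of an agent constrains
its statuses at the time `t - Δ(t)` of the latest received packet and at earlier times. By the
Markov property of the reversed chain `Y_t ↔ X_t ↔ X_{t-1} ↔ ⋯`, the conditional law of the
current status and safety level depends only on the latest received status
(`IsMarkovChainFrom.measureReal_and_segment`). Hence, given the joint history and the decision,
the safety level and the pair (delivery indicators, statuses) have conditional laws that are
functions of the state tuple and do not depend on the policy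
(`IsModel.measureReal_jointHistory_and_level`, `IsModel.measureReal_jointHistory_and_outcome`).
This is sufficiency for estimation, and, since the next state tuple is a function of the present
one, the decision, the delivery indicators and the statuses, also the controlled Markov property.

For the optimization, Bayes estimators computed from the state alone minimize each conditional
expected loss, which leaves a Markov decision problem with cost a function of the state tuple.
Over a finite horizon backward dynamic programming gives an optimal deterministic reduced policy
(`IsModel.integral_optimalCost_le`, `IsModel.exists_policy_integral_eq_optimalCost`). For the
average loss, a causal policy is replaced by the reduced policy that draws the decision from its
conditional law given the current state tuple; the law of the state tuple at each time, and with
it each expected cost, stays the same (`IsModel.exists_reducedPolicy`).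
-/

/-! ### Random variables with finitely many values -/

/-- A random variable with finite range whose fibers are measurable. The codomain carries no
σ-algebra, so that histories and states can be used as they are. -/
structure FinitelyValued {Ω α : Type*} [MeasurableSpace Ω] (Z : Ω → α) : Prop where
  finite_range : (Set.range Z).Finite
  measurableSet_fiber : ∀ z, MeasurableSet {ω | Z ω = z}

namespace FinitelyValued

variable {Ω α β : Type*} [MeasurableSpace Ω] {P : Measure Ω} {Z : Ω → α} {V : Ω → β}

lemma measurableSet_setOf (hZ : FinitelyValued Z) (p : α → Prop) :
    MeasurableSet {ω | p (Z ω)} := by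
  have : {ω | p (Z ω)} = ⋃ z ∈ Set.range Z ∩ {z | p z}, {ω | Z ω = z} := by
    ext ω
    simp
  rw [this]
  exact (hZ.finite_range.subset Set.inter_subset_left).measurableSet_biUnion
    fun z _ => hZ.measurableSet_fiber z

lemma comp (hZ : FinitelyValued Z) (f : α → β) : FinitelyValued fun ω => f (Z ω) where
  finite_range := by
    refine (hZ.finite_range.image f).subset ?_
    rintro _ ⟨ω, rfl⟩
    exact ⟨Z ω, ⟨ω, rfl⟩, rfl⟩
  measurableSet_fiber z := hZ.measurableSet_setOf fun x => f x = z

lemma prodMk (hZ : FinitelyValued Z) (hV : FinitelyValued V) :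
    FinitelyValued fun ω => (Z ω, V ω) where
  finite_range := by
    refine (hZ.finite_range.prod hV.finite_range).subset ?_
    rintro _ ⟨ω, rfl⟩
    exact ⟨⟨ω, rfl⟩, ⟨ω, rfl⟩⟩
  measurableSet_fiber z := by
    have : {ω | (Z ω, V ω) = z} = {ω | Z ω = z.1} ∩ {ω | V ω = z.2} := by
      ext ω
      simp [Prod.ext_iff]
    rw [this]
    exact (hZ.measurableSet_fiber _).inter (hV.measurableSet_fiber _)

lemma pi {ι : Type*} [Finite ι] {γ : ι → Type*} {Z : ∀ i, Ω → γ i}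
    (hZ : ∀ i, FinitelyValued (Z i)) : FinitelyValued fun ω i => Z i ω where
  finite_range := by
    refine (Set.Finite.pi' fun i => (hZ i).finite_range).subset ?_
    rintro _ ⟨ω, rfl⟩ i
    exact ⟨ω, rfl⟩
  measurableSet_fiber z := by
    have : {ω | (fun i => Z i ω) = z} = ⋂ i, {ω | Z i ω = z i} := by
      ext ω
      simp [funext_iff]
    rw [this]
    exact MeasurableSet.iInter fun i => (hZ i).measurableSet_fiber _

lemma of_measurable [Finite α] [MeasurableSpace α] [MeasurableSingletonClass α]
    (hZ : Measurable Z) : FinitelyValued Z where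
  finite_range := Set.toFinite _
  measurableSet_fiber z := hZ (measurableSet_singleton z)

lemma exists_finset (hZ : FinitelyValued Z) : ∃ s : Finset α, ∀ ω, Z ω ∈ s :=
  ⟨hZ.finite_range.toFinset, fun ω => by simp⟩

lemma integral_eq_sum [IsFiniteMeasure P] (hZ : FinitelyValued Z) {s : Finset α}
    (hs : ∀ ω, Z ω ∈ s) (f : α → ℝ) :
    ∫ ω, f (Z ω) ∂P = ∑ z ∈ s, P.real {ω | Z ω = z} * f z := by
  classical
  have h : ∀ ω, f (Z ω) = ∑ z ∈ s, {ω | Z ω = z}.indicator (fun _ => f z) ω := by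
    intro ω
    rw [Finset.sum_eq_single (Z ω)]
    · simp
    · intro z _ hz
      simp [Ne.symm hz]
    · intro h
      exact absurd (hs ω) h
  simp_rw [h]
  rw [integral_finsetSum]
  · refine Finset.sum_congr rfl fun z _ => ?_
    rw [integral_indicator_const _ (hZ.measurableSet_fiber z), smul_eq_mul]
  · intro z _
    exact (integrable_const _).indicator (hZ.measurableSet_fiber z)

lemma integrable [IsFiniteMeasure P] (hZ : FinitelyValued Z) (f : α → ℝ) :
    Integrable (fun ω => f (Z ω)) P := by
  have hf := hZ.comp f
  have hm : Measurable fun ω => f (Z ω) := fun s _ => hf.measurableSet_setOf (· ∈ s)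
  obtain ⟨C, hC⟩ := (hf.finite_range.image norm).bddAbove
  exact Integrable.of_bound hm.aestronglyMeasurable C
    (.of_forall fun ω => hC ⟨_, ⟨ω, rfl⟩, rfl⟩)

lemma measureReal_eq_sum_fiber [IsFiniteMeasure P] (hZ : FinitelyValued Z) {s : Finset α}
    (hs : ∀ ω, Z ω ∈ s) {e : Ω → Prop} (he : MeasurableSet {ω | e ω}) :
    P.real {ω | e ω} = ∑ z ∈ s, P.real {ω | Z ω = z ∧ e ω} := by
  have h : {ω | e ω} = ⋃ z ∈ s, {ω | Z ω = z ∧ e ω} := by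
    ext ω
    simp [hs ω]
  conv_lhs => rw [h]
  refine measureReal_biUnion_finset ?_ fun z _ => (hZ.measurableSet_fiber z).inter he
  intro z _ z' _ hzz
  refine Set.disjoint_left.2 ?_
  rintro ω ⟨h1, _⟩ ⟨h2, _⟩
  exact hzz (h1.symm.trans h2)

/-- If the conditional probability of the event `e` given `Z = z` has the same value `c` for all
`z` satisfying `p`, then this is also the conditional probability of `e` given `p Z`. -/
lemma measureReal_and_of_kernel [IsFiniteMeasure P] (hZ : FinitelyValued Z) {e : Ω → Prop}
    (he : MeasurableSet {ω | e ω}) {κ : α → ℝ}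
    (hκ : ∀ z, P.real {ω | Z ω = z ∧ e ω} = P.real {ω | Z ω = z} * κ z)
    (p : α → Prop) (c : ℝ) (hc : ∀ z, p z → κ z = c) :
    P.real {ω | p (Z ω) ∧ e ω} = P.real {ω | p (Z ω)} * c := by
  obtain ⟨s, hs⟩ := hZ.exists_finset
  rw [hZ.measureReal_eq_sum_fiber hs (e := fun ω => p (Z ω) ∧ e ω)
      ((hZ.measurableSet_setOf p).inter he),
    hZ.measureReal_eq_sum_fiber hs (hZ.measurableSet_setOf p), Finset.sum_mul]
  refine Finset.sum_congr rfl fun z _ => ?_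
  by_cases hz : p z
  · have h1 : {ω | Z ω = z ∧ p (Z ω) ∧ e ω} = {ω | Z ω = z ∧ e ω} := by
      ext ω
      simp only [Set.mem_ofPred_eq]
      constructor
      · rintro ⟨h, -, h'⟩
        exact ⟨h, h'⟩
      · rintro ⟨h, h'⟩
        exact ⟨h, h ▸ hz, h'⟩
    have h2 : {ω | Z ω = z ∧ p (Z ω)} = {ω | Z ω = z} := by
      ext ω
      simp only [Set.mem_ofPred_eq, and_iff_left_iff_imp]
      rintro rfl
      exact hz
    rw [h1, h2, hκ, hc z hz]
  · have h1 : {ω | Z ω = z ∧ p (Z ω) ∧ e ω} = ∅ := by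
      ext ω
      simp only [Set.mem_ofPred_eq, Set.mem_empty_iff_false, iff_false]
      rintro ⟨rfl, h, -⟩
      exact hz h
    have h2 : {ω | Z ω = z ∧ p (Z ω)} = ∅ := by
      ext ω
      simp only [Set.mem_ofPred_eq, Set.mem_empty_iff_false, iff_false]
      rintro ⟨rfl, h⟩
      exact hz h
    rw [h1, h2]
    simp

/-- Integration of a function of `(Z, V)` with the help of a conditional law of `V` given `Z`. -/
lemma integral_of_kernel [IsFiniteMeasure P] [Fintype β] (hZ : FinitelyValued Z)
    (hV : FinitelyValued V) {κ : α → β → ℝ}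
    (hκ : ∀ z b, P.real {ω | Z ω = z ∧ V ω = b} = P.real {ω | Z ω = z} * κ z b)
    (G : α → β → ℝ) :
    ∫ ω, G (Z ω) (V ω) ∂P = ∫ ω, ∑ b, κ (Z ω) b * G (Z ω) b ∂P := by
  obtain ⟨s, hs⟩ := hZ.exists_finset
  rw [(hZ.prodMk hV).integral_eq_sum (s := s ×ˢ Finset.univ) (fun ω => by simp [hs ω])
    (fun x => G x.1 x.2), hZ.integral_eq_sum hs (fun z => ∑ b, κ z b * G z b),
    Finset.sum_product]
  refine Finset.sum_congr rfl fun z _ => ?_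
  rw [Finset.mul_sum]
  refine Finset.sum_congr rfl fun b _ => ?_
  rw [← mul_assoc, ← hκ]
  simp [Prod.ext_iff]

end FinitelyValued

/-! ### Markov chains started from a discrete variable -/

namespace IsMarkovChainFrom

variable {Ω A B : Type*} [MeasurableSpace Ω] {P : Measure Ω} {V : Ω → B} {W : ℕ → Ω → A}

/-- The Markov property at time `k`, for arbitrary events of the past that fix the present. -/
lemma measureReal_and_next [IsFiniteMeasure P] (h : IsMarkovChainFrom P V W)
    (hV : FinitelyValued V) (hW : ∀ i, FinitelyValued (W i)) (k : ℕ) (a b : A)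
    (p : B × (Fin (k + 1) → A) → Prop) (hp : ∀ z, p z → z.2 (Fin.last k) = a) :
    P.real {ω | p (V ω, fun i => W i ω) ∧ W (k + 1) ω = b} =
      P.real {ω | p (V ω, fun i => W i ω)} *
        (P.real {ω | W k ω = a ∧ W (k + 1) ω = b} / P.real {ω | W k ω = a}) := by
  have hZ : FinitelyValued fun ω => (V ω, fun i : Fin (k + 1) => W i ω) :=
    hV.prodMk (FinitelyValued.pi fun i => hW _)
  refine hZ.measureReal_and_of_kernel ((hW (k + 1)).measurableSet_fiber b)
    (κ := fun z => P.real {ω | W k ω = z.2 (Fin.last k) ∧ W (k + 1) ω = b} /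
      P.real {ω | W k ω = z.2 (Fin.last k)}) ?_ p _ ?_
  · rintro ⟨v, z⟩
    have key := h k v (fun i => if hi : i < k + 1 then z ⟨i, hi⟩ else b)
    have e1 : {ω | V ω = v ∧ ∀ i ≤ k + 1,
        W i ω = (fun i => if hi : i < k + 1 then z ⟨i, hi⟩ else b) i} =
        {ω | (V ω, fun i : Fin (k + 1) => W i ω) = (v, z) ∧ W (k + 1) ω = b} := by
      ext ω
      simp only [Set.mem_ofPred_eq, Prod.mk.injEq, funext_iff, and_assoc]
      refine and_congr_right fun _ => ⟨fun hh => ⟨fun i => ?_, ?_⟩, ?_⟩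
      · simpa [Nat.le_of_lt_succ i.2] using hh i i.2.le
      · simpa using hh (k + 1) le_rfl
      · rintro ⟨h1, h2⟩ i hi
        by_cases hik : i < k + 1
        · simpa [hik] using h1 ⟨i, hik⟩
        · obtain rfl : i = k + 1 := by omega
          simpa using h2
    have e2 : {ω | V ω = v ∧ ∀ i ≤ k,
        W i ω = (fun i => if hi : i < k + 1 then z ⟨i, hi⟩ else b) i} =
        {ω | (V ω, fun i : Fin (k + 1) => W i ω) = (v, z)} := by
      ext ω
      simp only [Set.mem_ofPred_eq, Prod.mk.injEq, funext_iff]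
      refine and_congr_right fun _ => ⟨fun hh i => ?_, fun hh i hi => ?_⟩
      · simpa [Nat.le_of_lt_succ i.2] using hh i (Nat.le_of_lt_succ i.2)
      · simpa [Nat.lt_succ_of_le hi] using hh ⟨i, by omega⟩
    rw [e1, e2] at key
    simp only [lt_add_iff_pos_right, zero_lt_one, dite_true, lt_self_iff_false, dite_false] at key
    change _ * P.real {ω | W k ω = z (Fin.last k)} =
      _ * P.real {ω | W k ω = z (Fin.last k) ∧ W (k + 1) ω = b} at key
    -- If the condition has probability zero, so has the event on the left-hand side.
    by_cases h0 : P.real {ω | W k ω = z (Fin.last k)} = 0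
    · have hle : P.real {ω | (V ω, fun i : Fin (k + 1) => W i ω) = (v, z) ∧ W (k + 1) ω = b} ≤
          P.real {ω | W k ω = z (Fin.last k)} := by
        refine measureReal_mono ?_
        rintro ω ⟨hω, -⟩
        exact congrFun (Prod.ext_iff.1 hω).2 (Fin.last k)
      simp only [h0, div_zero, mul_zero]
      exact le_antisymm (h0 ▸ hle) measureReal_nonneg
    · rw [← mul_div_assoc, eq_div_iff h0]
      exact key
  · intro z hz
    rw [hp z hz]

/-- Given `W k`, the variables `V` and `W 0` are conditionally independent of the segment
`W (k + 1), …, W (k + m)`. -/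
lemma measureReal_and_segment_mul [IsFiniteMeasure P] (h : IsMarkovChainFrom P V W)
    (hV : FinitelyValued V) (hW : ∀ i, FinitelyValued (W i)) (q : B → A → Prop) (k : ℕ)
    (z : ℕ → A) (m : ℕ) :
    P.real {ω | q (V ω) (W 0 ω) ∧ ∀ i ≤ m, W (k + i) ω = z i} * P.real {ω | W k ω = z 0} =
      P.real {ω | q (V ω) (W 0 ω) ∧ W k ω = z 0} *
        P.real {ω | ∀ i ≤ m, W (k + i) ω = z i} := by
  induction m with
  | zero => simp
  | succ m ih =>
    have step : ∀ r : B → A → Prop,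
        P.real {ω | r (V ω) (W 0 ω) ∧ ∀ i ≤ m + 1, W (k + i) ω = z i} =
          P.real {ω | r (V ω) (W 0 ω) ∧ ∀ i ≤ m, W (k + i) ω = z i} *
            (P.real {ω | W (k + m) ω = z m ∧ W (k + m + 1) ω = z (m + 1)} /
              P.real {ω | W (k + m) ω = z m}) := by
      intro r
      have hs := h.measureReal_and_next hV hW (k + m) (z m) (z (m + 1))
        (fun y => r y.1 (y.2 0) ∧ ∀ i (hi : i ≤ m), y.2 ⟨k + i, by omega⟩ = z i)
        (fun y hy => hy.2 m le_rfl)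
      simp only [Fin.val_zero] at hs
      rw [← hs]
      congr 1
      ext ω
      simp only [Set.mem_ofPred_eq, and_assoc]
      refine and_congr_right fun _ => ⟨fun hh => ⟨fun i hi => hh i (by omega), hh _ le_rfl⟩, ?_⟩
      rintro ⟨h1, h2⟩ i hi
      rcases Nat.lt_or_ge m i with h3 | h3
      · obtain rfl : i = m + 1 := by omega
        exact h2
      · exact h1 i h3
    have s1 := step q
    have s2 := step fun _ _ => True
    simp only [true_and] at s2
    rw [s1, s2, mul_right_comm, ih, mul_assoc]

/-- The conditional probability of an event of `V` and `W 0`, given an event of the variables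
`W k, …, W (k + m)` that forces `W k = x`, is its conditional probability given `W k = x`. -/
lemma measureReal_and_segment [IsFiniteMeasure P] (h : IsMarkovChainFrom P V W)
    (hV : FinitelyValued V) (hW : ∀ i, FinitelyValued (W i)) (q : B → A → Prop) (k m : ℕ)
    (x : A) (p : (Fin (m + 1) → A) → Prop) (hp : ∀ z, p z → z 0 = x) :
    P.real {ω | p (fun i => W (k + i) ω) ∧ q (V ω) (W 0 ω)} =
      P.real {ω | p fun i => W (k + i) ω} *
        (P.real {ω | W k ω = x ∧ q (V ω) (W 0 ω)} / P.real {ω | W k ω = x}) := by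
  have hZ : FinitelyValued fun ω => fun i : Fin (m + 1) => W (k + i) ω :=
    FinitelyValued.pi fun i => hW _
  refine hZ.measureReal_and_of_kernel
    ((hV.prodMk (hW 0)).measurableSet_setOf fun y => q y.1 y.2)
    (κ := fun z => P.real {ω | W k ω = z 0 ∧ q (V ω) (W 0 ω)} / P.real {ω | W k ω = z 0}) ?_ p _ ?_
  · intro z
    have key := h.measureReal_and_segment_mul hV hW q k
      (fun i => if hi : i < m + 1 then z ⟨i, hi⟩ else x) m
    have e : ∀ ω, (∀ i ≤ m, W (k + i) ω = if hi : i < m + 1 then z ⟨i, hi⟩ else x) ↔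
        (fun i : Fin (m + 1) => W (k + i) ω) = z := by
      intro ω
      rw [funext_iff]
      refine ⟨fun hh i => ?_, fun hh i hi => ?_⟩
      · simpa [Nat.le_of_lt_succ i.2] using hh i (Nat.le_of_lt_succ i.2)
      · simpa [Nat.lt_succ_of_le hi] using hh ⟨i, by omega⟩
    simp only [e, Nat.zero_lt_succ, dite_true, Fin.mk_zero] at key
    simp only [and_comm (a := q _ _)] at key
    -- If the condition has probability zero, so has the event on the left-hand side.
    by_cases h0 : P.real {ω | W k ω = z 0} = 0
    · have hle : P.real {ω | (fun i : Fin (m + 1) => W (k + i) ω) = z ∧ q (V ω) (W 0 ω)} ≤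
          P.real {ω | W k ω = z 0} := by
        refine measureReal_mono ?_
        rintro ω ⟨hω, -⟩
        exact congrFun hω 0
      simp only [h0, div_zero, mul_zero]
      exact le_antisymm (h0 ▸ hle) measureReal_nonneg
    · rw [← mul_div_assoc, eq_div_iff h0, key, mul_comm]
  · intro z hz
    rw [hp z hz]

end IsMarkovChainFrom

/-! ### Dynamics of the joint history -/

/-- The state tuple that follows `s` when the decision is `a`, the delivery indicators are `g` and
the current statuses are `x`. -/
def JointState.next {N : ℕ} {𝒳 : Fin N → Type*} (s : JointState 𝒳) (a g : Fin N → Bool)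
    (x : ∀ n, 𝒳 n) : JointState 𝒳 :=
  fun n => if a n = true ∧ g n = true then (1, x n) else ((s n).1 + 1, (s n).2)

namespace MonitoringSystem

variable {N M : ℕ} {𝒳 𝒴 : Fin N → Type*} {Ω : Type*} (S : MonitoringSystem N 𝒳 𝒴 Ω)
  (π : CausalPolicy M 𝒳)

lemma state_snd_eq (ω : Ω) (t : ℕ) (n : Fin N) :
    (History.state (S.jointHistory π ω t n)).2 =
      S.X n ((t : ℤ) - ((History.state (S.jointHistory π ω t n)).1 : ℤ)) ω := by
  cases t with
  | zero => simp [History.state, jointHistory]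
  | succ t => simp [History.state, jointHistory]

lemma state_jointHistory_succ (ω : Ω) (t : ℕ) :
    JointHistory.state (S.jointHistory π ω (t + 1)) =
      (JointHistory.state (S.jointHistory π ω t)).next (S.decision π t ω) (fun n => S.γ n t ω)
        (fun n => S.X n t ω) := by
  funext n
  have h := S.state_snd_eq π ω t n
  simp only [History.state] at h
  simp only [JointHistory.state, History.state, jointHistory, Fin.snoc_last, JointState.next]
  rw [h]
  by_cases h1 : π.decide t (S.jointHistory π ω t) (S.U t ω) n = true ∧ S.γ n t ω = true
  · rw [if_pos h1, if_pos (show S.decision π t ω n = true ∧ S.γ n t ω = true from h1)]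
    simp
  · rw [if_neg h1,
      if_neg (show ¬(S.decision π t ω n = true ∧ S.γ n t ω = true) from h1)]
    simp

lemma jointHistory_succ_eq (ω : Ω) (t : ℕ) :
    S.jointHistory π ω (t + 1) = fun n =>
      Fin.snoc (α := fun _ => HistoryEntry (𝒳 n)) (S.jointHistory π ω t n)
        { packet := ((JointHistory.state (S.jointHistory π ω t)).next (S.decision π t ω)
            (fun n => S.γ n t ω) (fun n => S.X n t ω) n).2
          age := ((JointHistory.state (S.jointHistory π ω t)).next (S.decision π t ω)
            (fun n => S.γ n t ω) (fun n => S.X n t ω) n).1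
          pulled := S.decision π t ω n
          delivered := S.γ n t ω } := by
  rw [← state_jointHistory_succ]
  funext n
  simp only [JointHistory.state, History.state, jointHistory, Fin.snoc_last, decision]

lemma jointHistory_succ_eq_iff (ω ω₀ : Ω) (t : ℕ) :
    S.jointHistory π ω (t + 1) = S.jointHistory π ω₀ (t + 1) ↔
      S.jointHistory π ω t = S.jointHistory π ω₀ t ∧ (∀ n, S.γ n t ω = S.γ n t ω₀) ∧
        S.decision π t ω = S.decision π t ω₀ ∧
        ∀ n, S.X n (((t + 1 : ℕ) : ℤ) - (History.state (S.jointHistory π ω₀ (t + 1) n)).1) ω =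
          S.X n (((t + 1 : ℕ) : ℤ) - (History.state (S.jointHistory π ω₀ (t + 1) n)).1) ω₀ := by
  constructor
  · intro h
    have hst := fun n => S.state_snd_eq π ω (t + 1) n
    have hst₀ := fun n => S.state_snd_eq π ω₀ (t + 1) n
    have hn := fun n => congrFun h n
    simp only [jointHistory_succ_eq, Fin.snoc_inj, HistoryEntry.mk.injEq] at hn
    refine ⟨funext fun n => (hn n).1, fun n => (hn n).2.2.2.2, funext fun n => (hn n).2.2.2.1,
      fun n => ?_⟩
    have e := hst n
    rw [h] at e
    rw [← e, ← hst₀ n]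
  · rintro ⟨h1, h2, h3, h4⟩
    funext n
    have hage : ((JointHistory.state (S.jointHistory π ω t)).next (S.decision π t ω)
        (fun n => S.γ n t ω) (fun n => S.X n t ω) n).1 =
        (History.state (S.jointHistory π ω₀ (t + 1) n)).1 := by
      have := congrFun (S.state_jointHistory_succ π ω₀ t) n
      simp only [JointHistory.state] at this
      rw [this, h1, h3]
      simp only [JointState.next, h2]
      split_ifs <;> rfl
    have e := S.state_snd_eq π ω (t + 1) n
    have e₀ := S.state_snd_eq π ω₀ (t + 1) n
    have hs : JointHistory.state (S.jointHistory π ω (t + 1)) n =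
        JointHistory.state (S.jointHistory π ω₀ (t + 1)) n := by
      have hage' := hage
      rw [← state_jointHistory_succ] at hage'
      refine Prod.ext hage' ?_
      change (History.state (S.jointHistory π ω (t + 1) n)).2 = _
      rw [e]
      change _ = (History.state (S.jointHistory π ω₀ (t + 1) n)).2
      rw [e₀, ← h4 n]
      simp only [JointHistory.state] at hage'
      rw [hage']
    rw [state_jointHistory_succ, state_jointHistory_succ] at hs
    simp only [jointHistory_succ_eq]
    rw [hs, h1, h3, h2]

lemma jointHistory_and_decision_iff (t : ℕ) (h : JointHistory 𝒳 t) (a : Fin N → Bool) (ω : Ω) :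
    (S.jointHistory π ω t = h ∧ S.decision π t ω = a) ↔
      (S.jointHistory π ω t = h ∧ S.U t ω ∈ π.decide t h ⁻¹' {a}) := by
  refine and_congr_right fun hω => ?_
  rw [decision, hω]
  rfl

/-- The event that the joint history agrees with the one realised at `ω₀` is the intersection of
an event about the statuses of each agent, an event about the delivery indicators and an event
about the random numbers. -/
lemma jointHistory_eq_iff (ω ω₀ : Ω) (t : ℕ) :
    S.jointHistory π ω t = S.jointHistory π ω₀ t ↔
      (∀ n, ∀ τ ≤ t, S.X n ((τ : ℤ) - (History.state (S.jointHistory π ω₀ τ n)).1) ω =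
          S.X n ((τ : ℤ) - (History.state (S.jointHistory π ω₀ τ n)).1) ω₀) ∧
        (∀ τ < t, ∀ n, S.γ n τ ω = S.γ n τ ω₀) ∧
        ∀ τ < t, π.decide τ (S.jointHistory π ω₀ τ) (S.U τ ω) = S.decision π τ ω₀ := by
  induction t with
  | zero =>
    simp [jointHistory, funext_iff, History.state]
  | succ t ih =>
    rw [jointHistory_succ_eq_iff]
    constructor
    · rintro ⟨h, h2, h3, h4⟩
      obtain ⟨i1, i2, i3⟩ := ih.1 h
      refine ⟨fun n τ hτ => ?_, fun τ hτ => ?_, fun τ hτ => ?_⟩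
      · rcases Nat.lt_or_ge t τ with hlt | hle
        · obtain rfl : τ = t + 1 := by omega
          exact h4 n
        · exact i1 n τ hle
      · rcases Nat.lt_or_ge τ t with hlt | hle
        · exact i2 τ hlt
        · obtain rfl : τ = t := by omega
          exact h2
      · rcases Nat.lt_or_ge τ t with hlt | hle
        · exact i3 τ hlt
        · obtain rfl : τ = t := by omega
          rw [← h3, ← h]
          rfl
    · rintro ⟨i1, i2, i3⟩
      have h := ih.2 ⟨fun n τ hτ => i1 n τ (by omega), fun τ hτ => i2 τ (by omega),
        fun τ hτ => i3 τ (by omega)⟩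
      refine ⟨h, i2 t (by omega), ?_, fun n => i1 n (t + 1) le_rfl⟩
      rw [← i3 t (by omega), ← h]
      rfl

/-- The generation times of the latest received packets do not decrease. -/
lemma monotone_generationTime (ω : Ω) (n : Fin N) :
    Monotone fun t : ℕ => (t : ℤ) - (History.state (S.jointHistory π ω t n)).1 := by
  refine monotone_nat_of_le_succ fun t => ?_
  have h := congrFun (S.state_jointHistory_succ π ω t) n
  simp only [JointHistory.state] at h
  rw [h]
  simp only [JointState.next]
  split_ifs
  · push_cast
    omega
  · simp only [JointHistory.state]
    push_cast
    omega

/-- The status trajectories of agent `n` for which the packets received up to time `t` have the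
same contents as at the sample point `ω₀`, when the ages are those at `ω₀`. -/
def packetSet (ω₀ : Ω) (t : ℕ) (n : Fin N) : Set (ℤ → 𝒳 n) :=
  {x | ∀ τ ≤ t, x ((τ : ℤ) - (History.state (S.jointHistory π ω₀ τ n)).1) =
    S.X n ((τ : ℤ) - (History.state (S.jointHistory π ω₀ τ n)).1) ω₀}

lemma measurableSet_packetSet [∀ n, MeasurableSpace (𝒳 n)]
    [∀ n, MeasurableSingletonClass (𝒳 n)] (ω₀ : Ω) (t : ℕ) (n : Fin N) :
    MeasurableSet (S.packetSet π ω₀ t n) := by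
  have : S.packetSet π ω₀ t n = ⋂ τ ≤ t,
      (fun x : ℤ → 𝒳 n => x ((τ : ℤ) - (History.state (S.jointHistory π ω₀ τ n)).1)) ⁻¹'
        {S.X n ((τ : ℤ) - (History.state (S.jointHistory π ω₀ τ n)).1) ω₀} := by
    ext x
    simp [packetSet]
  rw [this]
  exact MeasurableSet.iInter fun τ => MeasurableSet.iInter fun _ =>
    measurable_pi_apply _ (measurableSet_singleton _)

/-! ### Measurability -/

variable [∀ n, MeasurableSpace (𝒳 n)] [∀ n, MeasurableSpace (𝒴 n)] [MeasurableSpace Ω]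
  {P : Measure Ω} {S}

lemma IsModel.finitelyValued_X [∀ n, Finite (𝒳 n)] [∀ n, MeasurableSingletonClass (𝒳 n)]
    (hS : S.IsModel P) (n : Fin N) (s : ℤ) : FinitelyValued (S.X n s) :=
  .of_measurable (hS.measurable_X n s)

lemma IsModel.finitelyValued_Y [∀ n, Finite (𝒴 n)] [∀ n, MeasurableSingletonClass (𝒴 n)]
    (hS : S.IsModel P) (n : Fin N) (t : ℕ) : FinitelyValued (S.Y n t) :=
  .of_measurable (hS.measurable_Y n t)

lemma IsModel.finitelyValued_delivery (hS : S.IsModel P) (t : ℕ) :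
    FinitelyValued fun ω n => S.γ n t ω :=
  .pi fun n => .of_measurable (hS.measurable_γ n t)

lemma IsModel.finitelyValued_status [∀ n, Finite (𝒳 n)] [∀ n, MeasurableSingletonClass (𝒳 n)]
    (hS : S.IsModel P) (t : ℕ) : FinitelyValued fun ω n => S.X n (t : ℤ) ω :=
  .pi fun n => hS.finitelyValued_X n t

lemma IsModel.finitelyValued_decision_of (hS : S.IsModel P) (t : ℕ)
    (hH : FinitelyValued fun ω => S.jointHistory π ω t) : FinitelyValued (S.decision π t) where
  finite_range := Set.toFinite _
  measurableSet_fiber a := by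
    have : {ω | S.decision π t ω = a} = ⋃ h ∈ Set.range fun ω => S.jointHistory π ω t,
        {ω | S.jointHistory π ω t = h} ∩ S.U t ⁻¹' (π.decide t h ⁻¹' {a}) := by
      ext ω
      simp only [decision, Set.mem_ofPred_eq, Set.mem_iUnion, Set.mem_inter_iff, Set.mem_preimage,
        Set.mem_singleton_iff, exists_prop]
      constructor
      · intro h
        exact ⟨_, ⟨ω, rfl⟩, rfl, h⟩
      · rintro ⟨_, -, rfl, h⟩
        exact h
    rw [this]
    exact hH.finite_range.measurableSet_biUnion fun h _ => (hH.measurableSet_fiber h).inter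
      (hS.measurable_U t (π.measurable_decide t h (measurableSet_singleton a)))

lemma IsModel.finitelyValued_jointHistory [∀ n, Finite (𝒳 n)]
    [∀ n, MeasurableSingletonClass (𝒳 n)] (hS : S.IsModel P) (t : ℕ) :
    FinitelyValued fun ω => S.jointHistory π ω t := by
  induction t with
  | zero =>
    exact (FinitelyValued.pi fun n => hS.finitelyValued_X n (-(S.initialAge n : ℤ))).comp
      fun x n (_ : Fin 1) => (⟨x n, S.initialAge n, S.initialPulled n, S.initialDelivered n⟩ :
        HistoryEntry (𝒳 n))
  | succ t ih =>
    simp only [jointHistory_succ_eq]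
    exact (ih.prodMk ((hS.finitelyValued_decision_of π t ih).prodMk
      ((hS.finitelyValued_delivery t).prodMk (hS.finitelyValued_status t)))).comp
      fun z n => Fin.snoc (α := fun _ => HistoryEntry (𝒳 n)) (z.1 n)
        ⟨((JointHistory.state z.1).next z.2.1 z.2.2.1 z.2.2.2 n).2,
          ((JointHistory.state z.1).next z.2.1 z.2.2.1 z.2.2.2 n).1, z.2.1 n, z.2.2.1 n⟩

lemma IsModel.finitelyValued_state [∀ n, Finite (𝒳 n)]
    [∀ n, MeasurableSingletonClass (𝒳 n)] (hS : S.IsModel P) (t : ℕ) :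
    FinitelyValued fun ω => JointHistory.state (S.jointHistory π ω t) :=
  (hS.finitelyValued_jointHistory π t).comp JointHistory.state

lemma IsModel.finitelyValued_decision [∀ n, Finite (𝒳 n)]
    [∀ n, MeasurableSingletonClass (𝒳 n)] (hS : S.IsModel P) (t : ℕ) :
    FinitelyValued (S.decision π t) :=
  hS.finitelyValued_decision_of π t (hS.finitelyValued_jointHistory π t)

/-! ### Independence -/

lemma _root_.ProbabilityTheory.iIndepFun.measureReal_forall_mem {ι : Type*} {β : ι → Type*}
    [∀ i, MeasurableSpace (β i)] {f : ∀ i, Ω → β i} (hf : iIndepFun f P) (s : Finset ι)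
    {A : ∀ i, Set (β i)} (hA : ∀ i, MeasurableSet (A i)) :
    P.real {ω | ∀ i ∈ s, f i ω ∈ A i} = ∏ i ∈ s, P.real {ω | f i ω ∈ A i} := by
  have h := hf.measure_inter_preimage_eq_mul s (sets := A) fun i _ => hA i
  have e : {ω | ∀ i ∈ s, f i ω ∈ A i} = ⋂ i ∈ s, f i ⁻¹' A i := by
    ext ω
    simp
  rw [measureReal_def, e, h, ENNReal.toReal_prod]
  rfl

/-- Statuses and safety levels, delivery indicators, and random numbers are independent. -/
lemma IsModel.measureReal_source_and (hS : S.IsModel P)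
    {E : Set ((∀ n, ℤ → 𝒳 n) × (∀ n, ℕ → 𝒴 n))} (hE : MeasurableSet E)
    {Γ : Set (Fin N → ℕ → Bool)} (hΓ : MeasurableSet Γ) {D : Set (ℕ → unitInterval)}
    (hD : MeasurableSet D) :
    P.real {ω | ((fun n s => S.X n s ω, fun n t => S.Y n t ω) ∈ E) ∧
        (fun n t => S.γ n t ω) ∈ Γ ∧ (fun t => S.U t ω) ∈ D} =
      P.real {ω | (fun n s => S.X n s ω, fun n t => S.Y n t ω) ∈ E} *
        (P.real {ω | (fun n t => S.γ n t ω) ∈ Γ} * P.real {ω | (fun t => S.U t ω) ∈ D}) := by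
  have h1 := hS.indep_source.measure_inter_preimage_eq_mul E (Γ ×ˢ D) hE (hΓ.prod hD)
  have h2 := hS.indep_delivery_U.measure_inter_preimage_eq_mul Γ D hΓ hD
  simp only [measureReal_def]
  rw [← ENNReal.toReal_mul, ← ENNReal.toReal_mul]
  congr 1
  refine Eq.trans ?_ (h1.trans ?_)
  · rfl
  · congr 1

/-- The current delivery indicators are independent of the past ones. -/
lemma IsModel.measureReal_delivery_lt_and (hS : S.IsModel P) (t : ℕ) (c : Fin N → ℕ → Bool)
    (g : Fin N → Bool) :
    P.real {ω | (∀ τ < t, ∀ n, S.γ n τ ω = c n τ) ∧ ∀ n, S.γ n t ω = g n} =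
      P.real {ω | ∀ τ < t, ∀ n, S.γ n τ ω = c n τ} * P.real {ω | ∀ n, S.γ n t ω = g n} := by
  have key := fun s => hS.indep_delivery.measureReal_forall_mem s
    (A := fun i => {if i.2 < t then c i.1 i.2 else g i.1}) fun i => measurableSet_singleton _
  have h1 := key (Finset.univ ×ˢ Finset.range (t + 1))
  have h2 := key (Finset.univ ×ˢ Finset.range t)
  have h3 := key (Finset.univ ×ˢ {t})
  rw [Finset.prod_product_right] at h1 h2 h3
  rw [Finset.prod_range_succ, ← h2] at h1
  rw [Finset.prod_singleton] at h3
  rw [← h3] at h1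
  convert h1 using 2
  · congr 1
    ext ω
    simp only [Finset.mem_product, Finset.mem_univ, true_and,
      Finset.mem_range, Prod.forall, Set.mem_singleton_iff]
    constructor
    · rintro ⟨h, h'⟩ n τ hτ
      split_ifs with hlt
      · exact h τ hlt n
      · obtain rfl : τ = t := by omega
        exact h' n
    · intro h
      refine ⟨fun τ hτ n => ?_, fun n => ?_⟩
      · simpa [hτ] using h n τ (by omega)
      · simpa using h n t (by omega)
  · congr 1
    ext ω
    simp only [Set.mem_ofPred_eq, Finset.mem_product, Finset.mem_univ, true_and,
      Finset.mem_range, Prod.forall, Set.mem_singleton_iff]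
    refine ⟨fun h n τ hτ => ?_, fun h τ hτ n => ?_⟩
    · simpa [hτ] using h τ hτ n
    · simpa [hτ] using h n τ hτ
  · congr 1
    ext ω
    simp

/-- The current random number is independent of the past ones. -/
lemma IsModel.measureReal_random_lt_and (hS : S.IsModel P) (t : ℕ) {D : ℕ → Set unitInterval}
    (hD : ∀ τ, MeasurableSet (D τ)) {B : Set unitInterval} (hB : MeasurableSet B) :
    P.real {ω | (∀ τ < t, S.U τ ω ∈ D τ) ∧ S.U t ω ∈ B} =
      P.real {ω | ∀ τ < t, S.U τ ω ∈ D τ} * (volume : Measure unitInterval).real B := by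
  have key := fun s => hS.indep_U.measureReal_forall_mem s
    (A := fun τ => if τ < t then D τ else B) fun τ => by split_ifs <;> simp [hD, hB]
  have h1 := key (Finset.range (t + 1))
  have h2 := key (Finset.range t)
  rw [Finset.prod_range_succ, ← h2] at h1
  rw [← hS.uniform_U t, map_measureReal_apply (hS.measurable_U t) hB]
  convert h1 using 2
  · congr 1
    ext ω
    simp only [Finset.mem_range]
    constructor
    · rintro ⟨h, h'⟩ τ hτ
      split_ifs with hlt
      · exact h τ hlt
      · obtain rfl : τ = t := by omega
        exact h'
    · intro h
      refine ⟨fun τ hτ => ?_, ?_⟩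
      · simpa [hτ] using h τ (by omega)
      · simpa using h t (by omega)
  · congr 1
    ext ω
    simp only [Set.mem_ofPred_eq, Finset.mem_range]
    refine forall₂_congr fun τ hτ => ?_
    simp [hτ]
  · simp
    rfl

/-- The status processes of different agents are independent. -/
lemma IsModel.measureReal_forall_status (hS : S.IsModel P) {A : ∀ n, Set (ℤ → 𝒳 n)}
    (hA : ∀ n, MeasurableSet (A n)) :
    P.real {ω | ∀ n, (fun s => S.X n s ω) ∈ A n} =
      ∏ n, P.real {ω | (fun s => S.X n s ω) ∈ A n} := by
  simpa using hS.indep_status.measureReal_forall_mem Finset.univ hA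

/-- Statuses of the other agents are independent of the status process and of the safety level of
an agent. -/
lemma IsModel.measureReal_forall_status_and (hS : S.IsModel P) {A : ∀ n, Set (ℤ → 𝒳 n)}
    (hA : ∀ n, MeasurableSet (A n)) (n : Fin N) (t : ℕ) {C : Set (𝒴 n)} (hC : MeasurableSet C) :
    P.real {ω | (∀ m, (fun s => S.X m s ω) ∈ A m) ∧ S.Y n t ω ∈ C} =
      P.real {ω | (fun s => S.X n s ω) ∈ A n ∧ S.Y n t ω ∈ C} *
        P.real {ω | ∀ m : {m // m ≠ n}, (fun s => S.X m s ω) ∈ A m} := by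
  have hO : MeasurableSet {x : ∀ m : {m : Fin N // m ≠ n}, ℤ → 𝒳 m |
      ∀ m : {m : Fin N // m ≠ n}, x m ∈ A m} := by
    have : {x : ∀ m : {m : Fin N // m ≠ n}, ℤ → 𝒳 m |
      ∀ m : {m : Fin N // m ≠ n}, x m ∈ A m} =
        Set.univ.pi fun m : {m : Fin N // m ≠ n} => A m := by
      ext x
      simp
    rw [this]
    exact MeasurableSet.univ_pi fun m => hA m
  have h := (hS.indep_agent n t).measure_inter_preimage_eq_mul (A n ×ˢ C) _
    ((hA n).prod hC) hO
  simp only [measureReal_def]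
  rw [← ENNReal.toReal_mul]
  congr 1
  refine Eq.trans ?_ h
  congr 1
  ext ω
  simp only [Set.mem_ofPred_eq, Set.mem_inter_iff, Set.mem_preimage, Set.mem_prod]
  constructor
  · rintro ⟨h1, h2⟩
    exact ⟨⟨h1 n, h2⟩, fun m => h1 m⟩
  · rintro ⟨⟨h1, h2⟩, h3⟩
    refine ⟨fun m => ?_, h2⟩
    by_cases hm : m = n
    · subst hm
      exact h1
    · exact h3 ⟨m, hm⟩

end MonitoringSystem

/-! ### Conditional laws given the joint history -/

namespace MonitoringSystem

variable {N M : ℕ} {𝒳 𝒴 : Fin N → Type*} {Ω : Type*} [MeasurableSpace Ω]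

/-- The conditional probability `P(Y_{n,t} = y | X_{n,t-δ} = x)` for the state `s = (δ, x)`; it is
`0` if the condition has probability `0`. -/
noncomputable def levelKernel (S : MonitoringSystem N 𝒳 𝒴 Ω) (P : Measure Ω) (n : Fin N) (t : ℕ)
    (s : ℕ × 𝒳 n) (y : 𝒴 n) : ℝ :=
  P.real {ω | S.X n ((t : ℤ) - s.1) ω = s.2 ∧ S.Y n t ω = y} /
    P.real {ω | S.X n ((t : ℤ) - s.1) ω = s.2}

/-- The conditional probability `P(X_{n,t} = x' | X_{n,t-δ} = x)` for the state `s = (δ, x)`; it is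
`0` if the condition has probability `0`. -/
noncomputable def statusKernel (S : MonitoringSystem N 𝒳 𝒴 Ω) (P : Measure Ω) (n : Fin N) (t : ℕ)
    (s : ℕ × 𝒳 n) (x' : 𝒳 n) : ℝ :=
  P.real {ω | S.X n ((t : ℤ) - s.1) ω = s.2 ∧ S.X n t ω = x'} /
    P.real {ω | S.X n ((t : ℤ) - s.1) ω = s.2}

/-- The conditional probability, given the state tuple `s` at time `t`, that the delivery
indicators and the statuses of all agents at time `t` are `o.1` and `o.2`. -/
noncomputable def outcomeKernel (S : MonitoringSystem N 𝒳 𝒴 Ω) (P : Measure Ω) (t : ℕ)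
    (s : JointState 𝒳) (o : (Fin N → Bool) × (∀ n, 𝒳 n)) : ℝ :=
  P.real {ω | ∀ n, S.γ n t ω = o.1 n} * ∏ n, S.statusKernel P n t (s n) (o.2 n)

variable {S : MonitoringSystem N 𝒳 𝒴 Ω} {P : Measure Ω} [∀ n, MeasurableSpace (𝒳 n)]
  [∀ n, MeasurableSingletonClass (𝒳 n)] [∀ n, MeasurableSpace (𝒴 n)] (π : CausalPolicy M 𝒳)

/-- Given the statuses of an agent at finitely many times, the latest of which is `t - k ≤ t`, the
conditional law of the current status and safety level depends only on the status at `t - k`. -/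
lemma IsModel.measureReal_packets_and [IsProbabilityMeasure P] [∀ n, Finite (𝒳 n)]
    [∀ n, Finite (𝒴 n)] [∀ n, MeasurableSingletonClass (𝒴 n)]
    (hS : S.IsModel P) (hA : S.MarkovAssumption P)
    (n : Fin N) (t k : ℕ) (c : ℕ → ℤ) (hc : Monotone c) (hk : c t = (t : ℤ) - k) (x : ℕ → 𝒳 n)
    (q : 𝒴 n → 𝒳 n → Prop) :
    P.real {ω | (∀ τ ≤ t, S.X n (c τ) ω = x τ) ∧ q (S.Y n t ω) (S.X n t ω)} =
      P.real {ω | ∀ τ ≤ t, S.X n (c τ) ω = x τ} *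
        (P.real {ω | S.X n ((t : ℤ) - k) ω = x t ∧ q (S.Y n t ω) (S.X n t ω)} /
          P.real {ω | S.X n ((t : ℤ) - k) ω = x t}) := by
  have hm : ∀ τ ≤ t, (c t - c τ).toNat ≤ (c t - c 0).toNat := fun τ _ =>
    Int.toNat_le_toNat (by have := hc (Nat.zero_le τ); omega)
  -- The backward chain reaches the generation time `c τ` after `k + (c t - c τ)` steps.
  have key := (hA n t).1.measureReal_and_segment (hS.finitelyValued_Y n t)
    (fun i => hS.finitelyValued_X n _) q k (c t - c 0).toNat (x t)
    (fun z => ∀ τ (hτ : τ ≤ t), z ⟨(c t - c τ).toNat, Nat.lt_succ_of_le (hm τ hτ)⟩ = x τ)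
    (fun z hz => by simpa using hz t le_rfl)
  have e : ∀ τ ≤ t, (t : ℤ) - ((k + (c t - c τ).toNat : ℕ) : ℤ) = c τ := by
    intro τ hτ
    have := hc hτ
    omega
  have e' : ∀ ω, (∀ τ (_ : τ ≤ t),
      S.X n ((t : ℤ) - ((k + (c t - c τ).toNat : ℕ) : ℤ)) ω = x τ) ↔
        ∀ τ ≤ t, S.X n (c τ) ω = x τ :=
    fun ω => forall₂_congr fun τ hτ => by rw [e τ hτ]
  simp only [e', Nat.cast_zero, sub_zero] at key
  exact key

lemma IsModel.measureReal_packetSet_and [IsProbabilityMeasure P]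
    [∀ n, Finite (𝒳 n)] [∀ n, Finite (𝒴 n)] [∀ n, MeasurableSingletonClass (𝒴 n)]
    (hS : S.IsModel P) (hA : S.MarkovAssumption P) (ω₀ : Ω)
    (n : Fin N) (t : ℕ) (q : 𝒴 n → 𝒳 n → Prop) :
    P.real {ω | (fun s => S.X n s ω) ∈ S.packetSet π ω₀ t n ∧ q (S.Y n t ω) (S.X n t ω)} =
      P.real {ω | (fun s => S.X n s ω) ∈ S.packetSet π ω₀ t n} *
        (P.real {ω | S.X n ((t : ℤ) - (History.state (S.jointHistory π ω₀ t n)).1) ω =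
              (History.state (S.jointHistory π ω₀ t n)).2 ∧ q (S.Y n t ω) (S.X n t ω)} /
          P.real {ω | S.X n ((t : ℤ) - (History.state (S.jointHistory π ω₀ t n)).1) ω =
              (History.state (S.jointHistory π ω₀ t n)).2}) := by
  rw [state_snd_eq]
  exact hS.measureReal_packets_and hA n t _ _ (S.monotone_generationTime π ω₀ n) rfl
    (fun τ => S.X n ((τ : ℤ) - (History.state (S.jointHistory π ω₀ τ n)).1) ω₀) q

/-- Factorization of an event that fixes the joint history and restricts the current random
number, the delivery indicators, and the statuses and safety levels. -/
lemma IsModel.measureReal_jointHistory_and (hS : S.IsModel P) (ω₀ : Ω) (t : ℕ)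
    {B : Set unitInterval} (hB : MeasurableSet B) {Γ : Set (Fin N → ℕ → Bool)}
    (hΓ : MeasurableSet Γ) {E : Set ((∀ n, ℤ → 𝒳 n) × (∀ n, ℕ → 𝒴 n))} (hE : MeasurableSet E) :
    P.real {ω | (S.jointHistory π ω t = S.jointHistory π ω₀ t ∧ S.U t ω ∈ B) ∧
        (fun n t => S.γ n t ω) ∈ Γ ∧ (fun n s => S.X n s ω, fun n t => S.Y n t ω) ∈ E} =
      P.real {ω | (∀ n, (fun s => S.X n s ω) ∈ S.packetSet π ω₀ t n) ∧
          (fun n s => S.X n s ω, fun n t => S.Y n t ω) ∈ E} *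
        (P.real {ω | (∀ τ < t, ∀ n, S.γ n τ ω = S.γ n τ ω₀) ∧ (fun n t => S.γ n t ω) ∈ Γ} *
          (P.real {ω | ∀ τ < t, S.U τ ω ∈
              π.decide τ (S.jointHistory π ω₀ τ) ⁻¹' {S.decision π τ ω₀}} *
            (volume : Measure unitInterval).real B)) := by
  have hD : ∀ τ, MeasurableSet
      (π.decide τ (S.jointHistory π ω₀ τ) ⁻¹' {S.decision π τ ω₀}) := fun τ =>
    π.measurable_decide τ _ (measurableSet_singleton _)
  rw [← hS.measureReal_random_lt_and t hD hB]
  have h1 : MeasurableSet ({y : (∀ n, ℤ → 𝒳 n) × (∀ n, ℕ → 𝒴 n) |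
      ∀ n, y.1 n ∈ S.packetSet π ω₀ t n} ∩ E) := by
    refine MeasurableSet.inter ?_ hE
    rw [Set.ofPred_forall]
    exact MeasurableSet.iInter fun n =>
      ((measurable_pi_apply n).comp measurable_fst) (S.measurableSet_packetSet π ω₀ t n)
  have h2 : MeasurableSet ({g : Fin N → ℕ → Bool | ∀ τ < t, ∀ n, g n τ = S.γ n τ ω₀} ∩ Γ) := by
    refine MeasurableSet.inter ?_ hΓ
    simp only [Set.ofPred_forall]
    exact MeasurableSet.iInter fun τ => MeasurableSet.iInter fun _ => MeasurableSet.iInter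
      fun n => ((measurable_pi_apply τ).comp (measurable_pi_apply n)) (measurableSet_singleton _)
  have h3 : MeasurableSet {u : ℕ → unitInterval | (∀ τ < t, u τ ∈
      π.decide τ (S.jointHistory π ω₀ τ) ⁻¹' {S.decision π τ ω₀}) ∧ u t ∈ B} := by
    rw [Set.ofPred_and]
    simp only [Set.ofPred_forall]
    exact (MeasurableSet.iInter fun τ => MeasurableSet.iInter fun _ =>
      measurable_pi_apply τ (hD τ)).inter (measurable_pi_apply t hB)
  refine Eq.trans ?_ (hS.measureReal_source_and h1 h2 h3)
  congr 1
  ext ω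
  simp only [Set.mem_ofPred_eq, jointHistory_eq_iff, packetSet, Set.mem_inter_iff,
    Set.mem_preimage, Set.mem_singleton_iff]
  tauto

lemma IsModel.measureReal_jointHistory_random [IsProbabilityMeasure P] (hS : S.IsModel P)
    (ω₀ : Ω) (t : ℕ) {B : Set unitInterval} (hB : MeasurableSet B) :
    P.real {ω | S.jointHistory π ω t = S.jointHistory π ω₀ t ∧ S.U t ω ∈ B} =
      P.real {ω | ∀ n, (fun s => S.X n s ω) ∈ S.packetSet π ω₀ t n} *
        (P.real {ω | ∀ τ < t, ∀ n, S.γ n τ ω = S.γ n τ ω₀} *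
          (P.real {ω | ∀ τ < t, S.U τ ω ∈
              π.decide τ (S.jointHistory π ω₀ τ) ⁻¹' {S.decision π τ ω₀}} *
            (volume : Measure unitInterval).real B)) := by
  simpa using hS.measureReal_jointHistory_and π ω₀ t hB MeasurableSet.univ MeasurableSet.univ

/-- The current random number is independent of the joint history. -/
lemma IsModel.measureReal_jointHistory_and_random [IsProbabilityMeasure P] (hS : S.IsModel P)
    (t : ℕ) (h : JointHistory 𝒳 t) {B : Set unitInterval} (hB : MeasurableSet B) :
    P.real {ω | S.jointHistory π ω t = h ∧ S.U t ω ∈ B} =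
      P.real {ω | S.jointHistory π ω t = h} * (volume : Measure unitInterval).real B := by
  -- A history that is not realised at any sample point gives empty events.
  by_cases hh : ∃ ω₀, S.jointHistory π ω₀ t = h
  · obtain ⟨ω₀, rfl⟩ := hh
    have h1 := hS.measureReal_jointHistory_random π ω₀ t MeasurableSet.univ
    simp only [Set.mem_univ, and_true, probReal_univ, mul_one] at h1
    rw [hS.measureReal_jointHistory_random π ω₀ t hB, h1]
    ring
  · simp [fun ω => not_exists.1 hh ω]

/-- Given the joint history, the current safety level of an agent is independent of the current
random number, and its conditional law is `levelKernel`. -/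
lemma IsModel.measureReal_jointHistory_and_level [IsProbabilityMeasure P]
    [∀ n, Finite (𝒳 n)] [∀ n, Finite (𝒴 n)] [∀ n, MeasurableSingletonClass (𝒴 n)]
    (hS : S.IsModel P) (hA : S.MarkovAssumption P) (t : ℕ)
    (h : JointHistory 𝒳 t) {B : Set unitInterval} (hB : MeasurableSet B) (n : Fin N) (y : 𝒴 n) :
    P.real {ω | (S.jointHistory π ω t = h ∧ S.U t ω ∈ B) ∧ S.Y n t ω = y} =
      P.real {ω | S.jointHistory π ω t = h ∧ S.U t ω ∈ B} *
        S.levelKernel P n t (History.state (h n)) y := by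
  -- A history that is not realised at any sample point gives empty events.
  by_cases hh : ∃ ω₀, S.jointHistory π ω₀ t = h
  · obtain ⟨ω₀, rfl⟩ := hh
    have hE : MeasurableSet {z : (∀ n, ℤ → 𝒳 n) × (∀ n, ℕ → 𝒴 n) | z.2 n t = y} := by
      have hm : Measurable fun z : (∀ n, ℤ → 𝒳 n) × (∀ n, ℕ → 𝒴 n) => z.2 n t := by fun_prop
      exact hm (measurableSet_singleton y)
    have h1 := hS.measureReal_jointHistory_and π ω₀ t hB MeasurableSet.univ
      hE
    simp only [Set.mem_univ, true_and, and_true, Set.mem_ofPred_eq] at h1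
    have hp := fun m => S.measurableSet_packetSet π ω₀ t m
    have h2 := hS.measureReal_forall_status_and hp n t (measurableSet_singleton y)
    have h3 := hS.measureReal_forall_status_and hp n t MeasurableSet.univ
    have h4 := hS.measureReal_packetSet_and π hA ω₀ n t fun y' _ => y' = y
    simp only [Set.mem_singleton_iff, Set.mem_univ, and_true] at h2 h3
    rw [h1, hS.measureReal_jointHistory_random π ω₀ t hB, h2, h3, h4, levelKernel]
    ring
  · simp [fun ω => not_exists.1 hh ω]

/-- Given the joint history, the current delivery indicators and statuses are independent of the
current random number, and their conditional law is `outcomeKernel`. -/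
lemma IsModel.measureReal_jointHistory_and_outcome [IsProbabilityMeasure P]
    [∀ n, Finite (𝒳 n)] [∀ n, Finite (𝒴 n)] [∀ n, MeasurableSingletonClass (𝒴 n)]
    (hS : S.IsModel P) (hA : S.MarkovAssumption P) (t : ℕ)
    (h : JointHistory 𝒳 t) {B : Set unitInterval} (hB : MeasurableSet B)
    (o : (Fin N → Bool) × (∀ n, 𝒳 n)) :
    P.real {ω | (S.jointHistory π ω t = h ∧ S.U t ω ∈ B) ∧
        (fun n => S.γ n t ω, fun n => S.X n t ω) = o} =
      P.real {ω | S.jointHistory π ω t = h ∧ S.U t ω ∈ B} *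
        S.outcomeKernel P t (JointHistory.state h) o := by
  -- A history that is not realised at any sample point gives empty events.
  by_cases hh : ∃ ω₀, S.jointHistory π ω₀ t = h
  · obtain ⟨ω₀, rfl⟩ := hh
    have hΓ : MeasurableSet {g : Fin N → ℕ → Bool | ∀ n, g n t = o.1 n} := by
      rw [Set.ofPred_forall]
      exact MeasurableSet.iInter fun n =>
        ((measurable_pi_apply t).comp (measurable_pi_apply n)) (measurableSet_singleton _)
    have hE : MeasurableSet {z : (∀ n, ℤ → 𝒳 n) × (∀ n, ℕ → 𝒴 n) | ∀ n, z.1 n t = o.2 n} := by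
      rw [Set.ofPred_forall]
      exact MeasurableSet.iInter fun n => ((measurable_pi_apply (t : ℤ)).comp
        ((measurable_pi_apply n).comp measurable_fst)) (measurableSet_singleton _)
    have h1 := hS.measureReal_jointHistory_and π ω₀ t hB hΓ hE
    simp only [Set.mem_ofPred_eq] at h1
    have hp := fun m => S.measurableSet_packetSet π ω₀ t m
    have h2 := hS.measureReal_forall_status hp
    have h3 := hS.measureReal_forall_status fun n => (hp n).inter
      ((measurable_pi_apply (t : ℤ)) (measurableSet_singleton (o.2 n)))
    simp only [Set.mem_inter_iff, Set.mem_preimage, Set.mem_singleton_iff, forall_and] at h3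
    have h4 := fun n => hS.measureReal_packetSet_and π hA ω₀ n t fun _ x => x = o.2 n
    have ho : ∀ ω, (fun n => S.γ n t ω, fun n => S.X n (t : ℤ) ω) = o ↔
        (∀ n, S.γ n t ω = o.1 n) ∧ ∀ n, S.X n t ω = o.2 n := fun ω => by
      rw [Prod.ext_iff, funext_iff, funext_iff]
    simp only [ho]
    rw [h1, hS.measureReal_jointHistory_random π ω₀ t hB, h2, h3,
      hS.measureReal_delivery_lt_and t (fun n τ => S.γ n τ ω₀) o.1]
    simp only [h4, Finset.prod_mul_distrib, outcomeKernel, statusKernel, JointHistory.state]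
    ring
  · simp [fun ω => not_exists.1 hh ω]

end MonitoringSystem

/-! ### Randomized decisions -/

namespace MonitoringSystem

/-- The feasible decisions: at most `M` agents are pulled. -/
abbrev FeasibleDecision (N M : ℕ) : Type :=
  {a : Fin N → Bool // (Finset.univ.filter fun n => a n = true).card ≤ M}

variable {N M : ℕ} {𝒳 𝒴 : Fin N → Type*} {Ω : Type*} [MeasurableSpace Ω]
  {S : MonitoringSystem N 𝒳 𝒴 Ω} {P : Measure Ω} [IsProbabilityMeasure P]
  [∀ n, Finite (𝒳 n)] [∀ n, MeasurableSpace (𝒳 n)] [∀ n, MeasurableSingletonClass (𝒳 n)]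
  [∀ n, MeasurableSpace (𝒴 n)]

instance : Nonempty (FeasibleDecision N M) := ⟨⟨fun _ => false, by simp⟩⟩

/-- A conditional law of the decision given the state tuple is realised by a function of a uniform
random number. -/
lemma IsModel.exists_randomized_decision (hS : S.IsModel P) (π : CausalPolicy M 𝒳) (t : ℕ)
    (s : JointState 𝒳) :
    ∃ r : unitInterval → FeasibleDecision N M, Measurable r ∧ ∀ a : Fin N → Bool,
      P.real {ω | JointHistory.state (S.jointHistory π ω t) = s ∧ S.decision π t ω = a} =
        P.real {ω | JointHistory.state (S.jointHistory π ω t) = s} *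
          (volume : Measure unitInterval).real {u | (r u : Fin N → Bool) = a} := by
  have hms := (hS.finitelyValued_state π t).measurableSet_fiber s
  -- If the condition has probability zero, so has the event on the left-hand side.
  by_cases h0 : P.real {ω | JointHistory.state (S.jointHistory π ω t) = s} = 0
  · refine ⟨fun _ => Classical.arbitrary _, measurable_const, fun a => ?_⟩
    rw [h0, zero_mul]
    exact le_antisymm (h0 ▸ measureReal_mono fun ω hω => hω.1) measureReal_nonneg
  · have := cond_isProbabilityMeasure (μ := P)
      (s := {ω | JointHistory.state (S.jointHistory π ω t) = s})
      fun h => h0 (by simp [measureReal_def, h])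
    have hd : Measurable (S.decision π t) := fun B _ =>
      (hS.finitelyValued_decision π t).measurableSet_setOf (· ∈ B)
    have hdm : Measurable fun ω =>
        (⟨S.decision π t ω, π.feasible t _ _⟩ : FeasibleDecision N M) := hd.subtype_mk
    have := Measure.isProbabilityMeasure_map (μ := P[|{ω |
      JointHistory.state (S.jointHistory π ω t) = s}]) hdm.aemeasurable
    obtain ⟨r, hr, hrm⟩ := (P[|{ω | JointHistory.state (S.jointHistory π ω t) = s}].map fun ω =>
        (⟨S.decision π t ω, π.feasible t _ _⟩ : FeasibleDecision N M)).exists_measurable_map_eq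
    refine ⟨r, hr, fun a => ?_⟩
    have hma : MeasurableSet {b : FeasibleDecision N M | (b : Fin N → Bool) = a} :=
      Set.Finite.measurableSet (Set.toFinite _)
    have h1 := congrArg (fun ν => ν.real {b : FeasibleDecision N M | (b : Fin N → Bool) = a}) hrm
    simp only [map_measureReal_apply hr hma, map_measureReal_apply hdm hma] at h1
    have h2 : (volume : Measure unitInterval).real {u | (r u : Fin N → Bool) = a} =
        P[|{ω | JointHistory.state (S.jointHistory π ω t) = s}].real
          {ω | S.decision π t ω = a} := h1
    rw [h2, measureReal_def (μ := P[|_]), cond_apply hms, ENNReal.toReal_mul, ENNReal.toReal_inv]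
    exact (mul_inv_cancel_left₀ h0 _).symm

lemma IsModel.measureReal_state_and_decision_reduced (hS : S.IsModel P) (ρ : ReducedPolicy M 𝒳)
    (t : ℕ) (s : JointState 𝒳) (a : Fin N → Bool) :
    P.real {ω | JointHistory.state (S.jointHistory ρ.toCausal ω t) = s ∧
        S.decision ρ.toCausal t ω = a} =
      P.real {ω | JointHistory.state (S.jointHistory ρ.toCausal ω t) = s} *
        (volume : Measure unitInterval).real (ρ.decide t s ⁻¹' {a}) := by
  refine (hS.finitelyValued_jointHistory ρ.toCausal t).measureReal_and_of_kernel
    ((hS.finitelyValued_decision ρ.toCausal t).measurableSet_fiber a)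
    (κ := fun h => (volume : Measure unitInterval).real
      (ρ.decide t (JointHistory.state h) ⁻¹' {a})) (fun h => ?_)
    (fun h => JointHistory.state h = s) _ fun h hh => by rw [hh]
  simp only [jointHistory_and_decision_iff]
  exact hS.measureReal_jointHistory_and_random ρ.toCausal t h
    (ρ.measurable_decide t _ (measurableSet_singleton a))

end MonitoringSystem

/-! ### Conditional expectations given the state -/

namespace MonitoringSystem

variable {N : ℕ} {𝒳 𝒴 : Fin N → Type*} {Ω : Type*} [MeasurableSpace Ω]

/-- The conditional expected loss of the estimate `d` when the state of the agent is `s`. -/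
noncomputable def conditionalLoss [∀ n, Fintype (𝒴 n)] (S : MonitoringSystem N 𝒳 𝒴 Ω)
    (P : Measure Ω) (L : (n : Fin N) → 𝒴 n → 𝒴 n → ℝ) (n : Fin N) (t : ℕ)
    (s : ℕ × 𝒳 n) (d : 𝒴 n) : ℝ :=
  ∑ y, S.levelKernel P n t s y * L n y d

/-- Reduced estimators are Bayes estimators if they minimize the conditional expected loss in every
state. -/
def IsBayes [∀ n, Fintype (𝒴 n)] (S : MonitoringSystem N 𝒳 𝒴 Ω) (P : Measure Ω)
    (L : (n : Fin N) → 𝒴 n → 𝒴 n → ℝ) (f : ReducedEstimators 𝒳 𝒴) : Prop :=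
  ∀ n t s d, S.conditionalLoss P L n t s (f n t s) ≤ S.conditionalLoss P L n t s d

lemma exists_isBayes [∀ n, Fintype (𝒴 n)] [∀ n, Nonempty (𝒴 n)]
    (S : MonitoringSystem N 𝒳 𝒴 Ω) (P : Measure Ω) (L : (n : Fin N) → 𝒴 n → 𝒴 n → ℝ) :
    ∃ f, S.IsBayes P L f := by
  choose f hf using fun (n : Fin N) (t : ℕ) (s : ℕ × 𝒳 n) =>
    Finite.exists_min (S.conditionalLoss P L n t s)
  exact ⟨f, hf⟩

/-- The expectation of `f (S_{t+1})` when the state tuple at time `t` is `s` and the decision is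
`a`. -/
noncomputable def transition [∀ n, Fintype (𝒳 n)] (S : MonitoringSystem N 𝒳 𝒴 Ω) (P : Measure Ω)
    (t : ℕ) (f : JointState 𝒳 → ℝ) (s : JointState 𝒳) (a : Fin N → Bool) : ℝ :=
  ∑ o, S.outcomeKernel P t s o * f (s.next a o.1 o.2)

end MonitoringSystem

/-! ### Sufficiency for estimation and for scheduling -/

namespace MonitoringSystem

variable {N M : ℕ} {𝒳 𝒴 : Fin N → Type*} {Ω : Type*} [MeasurableSpace Ω]
  {S : MonitoringSystem N 𝒳 𝒴 Ω} {P : Measure Ω} [IsProbabilityMeasure P]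
  [∀ n, Fintype (𝒳 n)] [∀ n, MeasurableSpace (𝒳 n)] [∀ n, MeasurableSingletonClass (𝒳 n)]
  [∀ n, Fintype (𝒴 n)] [∀ n, MeasurableSpace (𝒴 n)] [∀ n, MeasurableSingletonClass (𝒴 n)]

lemma IsModel.measureReal_decision_and_level (hS : S.IsModel P) (hA : S.MarkovAssumption P)
    (π : CausalPolicy M 𝒳) (t : ℕ) (h : JointHistory 𝒳 t) (a : Fin N → Bool) (n : Fin N)
    (y : 𝒴 n) :
    P.real {ω | S.jointHistory π ω t = h ∧ S.decision π t ω = a ∧ S.Y n t ω = y} =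
      P.real {ω | S.jointHistory π ω t = h ∧ S.decision π t ω = a} *
        S.levelKernel P n t (History.state (h n)) y := by
  simp only [← and_assoc, jointHistory_and_decision_iff]
  exact hS.measureReal_jointHistory_and_level π hA t h
    (π.measurable_decide t h (measurableSet_singleton a)) n y

lemma IsModel.measureReal_decision_and_outcome (hS : S.IsModel P) (hA : S.MarkovAssumption P)
    (π : CausalPolicy M 𝒳) (t : ℕ) (h : JointHistory 𝒳 t) (a : Fin N → Bool)
    (o : (Fin N → Bool) × (∀ n, 𝒳 n)) :
    P.real {ω | (S.jointHistory π ω t = h ∧ S.decision π t ω = a) ∧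
        (fun n => S.γ n t ω, fun n => S.X n t ω) = o} =
      P.real {ω | S.jointHistory π ω t = h ∧ S.decision π t ω = a} *
        S.outcomeKernel P t (JointHistory.state h) o := by
  simp only [jointHistory_and_decision_iff]
  exact hS.measureReal_jointHistory_and_outcome π hA t h
    (π.measurable_decide t h (measurableSet_singleton a)) o

lemma IsModel.measureReal_level (hS : S.IsModel P) (hA : S.MarkovAssumption P)
    (π : CausalPolicy M 𝒳) (t : ℕ) (n : Fin N) (h : JointHistory 𝒳 t) (y : 𝒴 n) :
    P.real {ω | S.jointHistory π ω t = h ∧ S.Y n t ω = y} =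
      P.real {ω | S.jointHistory π ω t = h} * S.levelKernel P n t (History.state (h n)) y := by
  simpa using hS.measureReal_jointHistory_and_level π hA t h MeasurableSet.univ n y

/-- The state of an agent is sufficient for estimating its safety level. -/
lemma IsModel.isSufficientStatistic_state (hS : S.IsModel P) (hA : S.MarkovAssumption P)
    (π : CausalPolicy M 𝒳) (n : Fin N) (t : ℕ) :
    IsSufficientStatistic P (fun ω => S.jointHistory π ω t n) History.state (S.Y n t) := by
  intro h v
  have key := (hS.finitelyValued_jointHistory π t).measureReal_and_of_kernel
    ((hS.finitelyValued_Y n t).measurableSet_fiber v) fun h => hS.measureReal_level hA π t n h v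
  rw [key (fun h' => h' n = h) (S.levelKernel P n t (History.state h) v)
      fun z hz => by rw [hz],
    key (fun h' => History.state (h' n) = History.state h)
      (S.levelKernel P n t (History.state h) v) fun z hz => by rw [hz]]
  ring

open Classical in
/-- Given the joint history and the decision, the law of the next state tuple depends only on the
current state tuple and on the decision. -/
lemma IsModel.measureReal_state_succ (hS : S.IsModel P) (hA : S.MarkovAssumption P)
    (π : CausalPolicy M 𝒳) (t : ℕ) (h : JointHistory 𝒳 t) (a : Fin N → Bool)
    (s : JointState 𝒳) :
    P.real {ω | S.jointHistory π ω t = h ∧ S.decision π t ω = a ∧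
        JointHistory.state (S.jointHistory π ω (t + 1)) = s} =
      P.real {ω | S.jointHistory π ω t = h ∧ S.decision π t ω = a} *
        S.transition P t (fun s' => if s' = s then 1 else 0) (JointHistory.state h) a := by
  have hV := (hS.finitelyValued_delivery t).prodMk (hS.finitelyValued_status t)
  have hZ := (hS.finitelyValued_jointHistory π t).prodMk
    ((hS.finitelyValued_decision π t).prodMk (hS.finitelyValued_jointHistory π (t + 1)))
  rw [hV.measureReal_eq_sum_fiber (s := Finset.univ) (fun _ => Finset.mem_univ _)
    (hZ.measurableSet_setOf fun z => z.1 = h ∧ z.2.1 = a ∧ JointHistory.state z.2.2 = s),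
    transition, Finset.mul_sum]
  refine Finset.sum_congr rfl fun o _ => ?_
  rw [← mul_assoc, ← hS.measureReal_decision_and_outcome hA, mul_ite, mul_one, mul_zero]
  have e : ∀ ω, (fun n => S.γ n t ω, fun n => S.X n (t : ℤ) ω) = o →
      S.jointHistory π ω t = h → S.decision π t ω = a →
      JointHistory.state (S.jointHistory π ω (t + 1)) =
        (JointHistory.state h).next a o.1 o.2 := by
    rintro ω rfl rfl rfl
    exact S.state_jointHistory_succ π ω t
  split_ifs with hs
  · congr 1
    ext ω
    simp only [Set.mem_ofPred_eq]
    constructor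
    · rintro ⟨h1, h2, h3, -⟩
      exact ⟨⟨h2, h3⟩, h1⟩
    · rintro ⟨⟨h2, h3⟩, h1⟩
      exact ⟨h1, h2, h3, (e ω h1 h2 h3).trans hs⟩
  · convert measureReal_empty
    ext ω
    simp only [Set.mem_ofPred_eq, Set.mem_empty_iff_false, iff_false]
    rintro ⟨h1, h2, h3, h4⟩
    exact hs ((e ω h1 h2 h3).symm.trans h4)

/-- The controlled Markov property of the state tuple, in integrated form. -/
lemma IsModel.integral_state_succ (hS : S.IsModel P) (hA : S.MarkovAssumption P)
    (π : CausalPolicy M 𝒳) (t : ℕ) (f : JointState 𝒳 → ℝ) :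
    ∫ ω, f (JointHistory.state (S.jointHistory π ω (t + 1))) ∂P =
      ∫ ω, S.transition P t f (JointHistory.state (S.jointHistory π ω t))
        (S.decision π t ω) ∂P := by
  have key := ((hS.finitelyValued_jointHistory π t).prodMk
    (hS.finitelyValued_decision π t)).integral_of_kernel (P := P)
    ((hS.finitelyValued_delivery t).prodMk (hS.finitelyValued_status t))
    (κ := fun z o => S.outcomeKernel P t (JointHistory.state z.1) o)
    (fun z o => by
      obtain ⟨h, a⟩ := z
      simp only [Prod.mk.injEq (S.jointHistory π _ t)]
      exact hS.measureReal_decision_and_outcome hA π t h a o)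
    (fun z o => f ((JointHistory.state z.1).next z.2 o.1 o.2))
  simp only [state_jointHistory_succ]
  exact key

/-! ### Estimation with minimal conditional expected loss -/

lemma IsModel.expectedLoss_eq (hS : S.IsModel P) (hA : S.MarkovAssumption P)
    (L : (n : Fin N) → 𝒴 n → 𝒴 n → ℝ) (π : CausalPolicy M 𝒳) (φ : Estimators 𝒳 𝒴) (n : Fin N)
    (t : ℕ) :
    S.expectedLoss P L π φ n t =
      ∫ ω, S.conditionalLoss P L n t (History.state (S.jointHistory π ω t n))
        (φ n t (S.jointHistory π ω t n)) ∂P :=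
  (hS.finitelyValued_jointHistory π t).integral_of_kernel (hS.finitelyValued_Y n t)
    (fun h y => hS.measureReal_level hA π t n h y) fun h y => L n y (φ n t (h n))

/-- Bayes estimators that use only the state are at least as good as all estimators. -/
lemma IsModel.integral_conditionalLoss_le (hS : S.IsModel P) (hA : S.MarkovAssumption P)
    {L : (n : Fin N) → 𝒴 n → 𝒴 n → ℝ} {f : ReducedEstimators 𝒳 𝒴} (hf : S.IsBayes P L f)
    (π : CausalPolicy M 𝒳) (φ : Estimators 𝒳 𝒴) (n : Fin N) (t : ℕ) :
    ∫ ω, S.conditionalLoss P L n t (JointHistory.state (S.jointHistory π ω t) n)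
        (f n t (JointHistory.state (S.jointHistory π ω t) n)) ∂P ≤
      S.expectedLoss P L π φ n t := by
  rw [hS.expectedLoss_eq hA]
  exact integral_mono
    ((hS.finitelyValued_state π t).integrable fun s => S.conditionalLoss P L n t (s n)
      (f n t (s n)))
    ((hS.finitelyValued_jointHistory π t).integrable fun h => S.conditionalLoss P L n t
      (History.state (h n)) (φ n t (h n)))
    fun ω => hf n t _ _

/-! ### Finite horizons: dynamic programming -/

/-- The optimal cost of `k` further slots from the state tuple `s` at time `t`, when slot `t` costs
`C t s`. -/
noncomputable def optimalCost (S : MonitoringSystem N 𝒳 𝒴 Ω) (P : Measure Ω) (M : ℕ)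
    (C : ℕ → JointState 𝒳 → ℝ) : ℕ → ℕ → JointState 𝒳 → ℝ
  | 0, _, _ => 0
  | k + 1, t, s => C t s +
      ⨅ a : FeasibleDecision N M, S.transition P t (optimalCost S P M C k (t + 1)) s a

/-- No causal policy has a smaller expected cost than the optimal one. -/
lemma IsModel.integral_optimalCost_le (hS : S.IsModel P) (hA : S.MarkovAssumption P)
    (C : ℕ → JointState 𝒳 → ℝ) (π : CausalPolicy M 𝒳) (k t : ℕ) :
    ∫ ω, S.optimalCost P M C k t (JointHistory.state (S.jointHistory π ω t)) ∂P ≤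
      ∑ i ∈ Finset.range k,
        ∫ ω, C (t + i) (JointHistory.state (S.jointHistory π ω (t + i))) ∂P := by
  induction k generalizing t with
  | zero => simp [optimalCost]
  | succ k ih =>
    have hs := hS.finitelyValued_state π t
    have hsa := hs.prodMk (hS.finitelyValued_decision π t)
    rw [Finset.sum_range_succ']
    have h1 := ih (t + 1)
    rw [hS.integral_state_succ hA] at h1
    have h2 : ∫ ω, S.optimalCost P M C (k + 1) t (JointHistory.state (S.jointHistory π ω t)) ∂P ≤
        ∫ ω, (C t (JointHistory.state (S.jointHistory π ω t)) +
          S.transition P t (S.optimalCost P M C k (t + 1))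
            (JointHistory.state (S.jointHistory π ω t)) (S.decision π t ω)) ∂P := by
      refine integral_mono (hs.integrable _) ((hs.integrable (C t)).add
        (hsa.integrable fun z => S.transition P t _ z.1 z.2)) fun ω => ?_
      simp only [optimalCost]
      gcongr
      exact ciInf_le (Set.finite_range _).bddBelow
        (⟨S.decision π t ω, π.feasible t _ _⟩ : FeasibleDecision N M)
    rw [integral_add (hs.integrable (C t))
      (hsa.integrable fun z => S.transition P t _ z.1 z.2)] at h2
    have e : ∀ i, ∫ ω, C (t + 1 + i) (JointHistory.state (S.jointHistory π ω (t + 1 + i))) ∂P =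
        ∫ ω, C (t + (i + 1)) (JointHistory.state (S.jointHistory π ω (t + (i + 1)))) ∂P :=
      fun i => by rw [show t + 1 + i = t + (i + 1) by omega]
    simp only [e] at h1
    change _ ≤ _ + ∫ ω, C t (JointHistory.state (S.jointHistory π ω t)) ∂P
    linarith

/-- A deterministic reduced policy attains the optimal cost over a finite horizon. -/
lemma IsModel.exists_policy_integral_eq_optimalCost (hS : S.IsModel P)
    (hA : S.MarkovAssumption P) (C : ℕ → JointState 𝒳 → ℝ) (T : ℕ) :
    ∃ ρ : ReducedPolicy M 𝒳, ρ.IsDeterministic ∧ ∀ k t, t + k = T →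
      ∑ i ∈ Finset.range k,
        ∫ ω, C (t + i) (JointHistory.state (S.jointHistory ρ.toCausal ω (t + i))) ∂P =
      ∫ ω, S.optimalCost P M C k t (JointHistory.state (S.jointHistory ρ.toCausal ω t)) ∂P := by
  choose d hd using fun (t : ℕ) (s : JointState 𝒳) =>
    exists_eq_ciInf_of_finite (f := fun a : FeasibleDecision N M =>
      S.transition P t (S.optimalCost P M C (T - (t + 1)) (t + 1)) s a)
  let ρ : ReducedPolicy M 𝒳 :=
    { decide := fun t s _ => d t s
      measurable_decide := fun t s => measurable_const
      feasible := fun t s _ => (d t s).2 }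
  refine ⟨ρ, fun _ _ _ _ => rfl, fun k => ?_⟩
  induction k with
  | zero => simp [optimalCost]
  | succ k ih =>
    intro t ht
    have hs := hS.finitelyValued_state ρ.toCausal t
    have hsa := hs.prodMk (hS.finitelyValued_decision ρ.toCausal t)
    rw [Finset.sum_range_succ']
    have h1 := ih (t + 1) (by omega)
    have e : ∀ i, ∫ ω, C (t + 1 + i)
        (JointHistory.state (S.jointHistory ρ.toCausal ω (t + 1 + i))) ∂P =
        ∫ ω, C (t + (i + 1))
          (JointHistory.state (S.jointHistory ρ.toCausal ω (t + (i + 1)))) ∂P :=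
      fun i => by rw [show t + 1 + i = t + (i + 1) by omega]
    simp only [e] at h1
    rw [h1, hS.integral_state_succ hA, add_zero, add_comm, ← integral_add (hs.integrable (C t))
      (hsa.integrable fun z => S.transition P t _ z.1 z.2)]
    refine integral_congr_ae (.of_forall fun ω => ?_)
    have h2 := hd t (JointHistory.state (S.jointHistory ρ.toCausal ω t))
    rw [show T - (t + 1) = k by omega] at h2
    simp only [optimalCost]
    rw [← h2]
    rfl

/-! ### Policies that reproduce the law of the state tuples -/

/-- For every causal policy there is a reduced policy under which the state tuple has the same law
at each time: it draws the decision from the conditional law, under the causal policy, of the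
decision given the current state tuple. -/
lemma IsModel.exists_reducedPolicy (hS : S.IsModel P) (hA : S.MarkovAssumption P)
    (π : CausalPolicy M 𝒳) :
    ∃ ρ : ReducedPolicy M 𝒳, ∀ (t : ℕ) (f : JointState 𝒳 → ℝ),
      ∫ ω, f (JointHistory.state (S.jointHistory ρ.toCausal ω t)) ∂P =
        ∫ ω, f (JointHistory.state (S.jointHistory π ω t)) ∂P := by
  choose r hr hrP using fun t s => hS.exists_randomized_decision π t s
  let ρ : ReducedPolicy M 𝒳 :=
    { decide := fun t s u => r t s u
      measurable_decide := fun t s => measurable_subtype_coe.comp (hr t s)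
      feasible := fun t s u => (r t s u).2 }
  refine ⟨ρ, fun t => ?_⟩
  induction t with
  | zero => exact fun f => rfl
  | succ t ih =>
    intro f
    rw [hS.integral_state_succ hA, hS.integral_state_succ hA,
      (hS.finitelyValued_state ρ.toCausal t).integral_of_kernel
        (hS.finitelyValued_decision ρ.toCausal t)
        (hS.measureReal_state_and_decision_reduced ρ t) (S.transition P t f),
      (hS.finitelyValued_state π t).integral_of_kernel (hS.finitelyValued_decision π t)
        (hrP t) (S.transition P t f)]
    exact ih fun s => ∑ a, (volume : Measure unitInterval).real (ρ.decide t s ⁻¹' {a}) *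
      S.transition P t f s a

end MonitoringSystem

/-! ### Long-run average loss -/

lemma abs_sum_average_le {N : ℕ} {e : Fin N → ℕ → ℝ} {B : Fin N → ℝ} (h : ∀ n t, |e n t| ≤ B n)
    (T : ℕ) : |∑ n, (1 / (T : ℝ)) * ∑ t ∈ Finset.range T, e n t| ≤ ∑ n, B n := by
  refine (Finset.abs_sum_le_sum_abs _ _).trans (Finset.sum_le_sum fun n _ => ?_)
  rcases T.eq_zero_or_pos with rfl | hT
  · simpa using (abs_nonneg _).trans (h n 0)
  · have hT' : (0 : ℝ) < T := by exact_mod_cast hT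
    have h1 : |∑ t ∈ Finset.range T, e n t| ≤ T * B n := by
      refine (Finset.abs_sum_le_sum_abs _ _).trans ?_
      simpa using Finset.sum_le_sum (s := Finset.range T) fun t _ => h n t
    rw [abs_mul, abs_of_pos (by positivity), one_div, inv_mul_le_iff₀ hT']
    exact h1

namespace MonitoringSystem

variable {N M : ℕ} {𝒳 𝒴 : Fin N → Type*} {Ω : Type*} [MeasurableSpace Ω]
  {S : MonitoringSystem N 𝒳 𝒴 Ω} {P : Measure Ω} [IsProbabilityMeasure P] [∀ n, Fintype (𝒴 n)]

lemma abs_expectedLoss_le (L : (n : Fin N) → 𝒴 n → 𝒴 n → ℝ) (π : CausalPolicy M 𝒳)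
    (φ : Estimators 𝒳 𝒴) (n : Fin N) (t : ℕ) :
    |S.expectedLoss P L π φ n t| ≤ ∑ z : 𝒴 n × 𝒴 n, |L n z.1 z.2| := by
  have h := norm_integral_le_of_norm_le_const (μ := P)
    (f := fun ω => L n (S.Y n t ω) (φ n t (S.jointHistory π ω t n)))
    (C := ∑ z : 𝒴 n × 𝒴 n, |L n z.1 z.2|) (.of_forall fun ω =>
      Finset.single_le_sum (f := fun z : 𝒴 n × 𝒴 n => |L n z.1 z.2|)
        (fun _ _ => abs_nonneg _)
        (Finset.mem_univ (S.Y n t ω, φ n t (S.jointHistory π ω t n))))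
  rw [probReal_univ, mul_one] at h
  exact h

lemma averageLoss_le_averageLoss (L : (n : Fin N) → 𝒴 n → 𝒴 n → ℝ) {π π' : CausalPolicy M 𝒳}
    {φ φ' : Estimators 𝒳 𝒴}
    (h : ∀ n t, S.expectedLoss P L π φ n t ≤ S.expectedLoss P L π' φ' n t) :
    S.averageLoss P L π φ ≤ S.averageLoss P L π' φ' := by
  have hb := fun (π : CausalPolicy M 𝒳) (φ : Estimators 𝒳 𝒴) (T : ℕ) =>
    abs_le.1 (abs_sum_average_le (S.abs_expectedLoss_le (P := P) L π φ) T)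
  refine limsup_le_limsup (.of_forall fun T => ?_)
    (isBoundedUnder_of ⟨_, fun T => (hb π φ T).1⟩).isCoboundedUnder_le
    (isBoundedUnder_of ⟨_, fun T => (hb π' φ' T).2⟩)
  dsimp only
  gcongr with n _ t _
  exact h n t

lemma neg_le_averageLoss (L : (n : Fin N) → 𝒴 n → 𝒴 n → ℝ) (π : CausalPolicy M 𝒳)
    (φ : Estimators 𝒳 𝒴) :
    -∑ n, ∑ z : 𝒴 n × 𝒴 n, |L n z.1 z.2| ≤ S.averageLoss P L π φ := by
  have hb := fun (T : ℕ) =>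
    abs_le.1 (abs_sum_average_le (S.abs_expectedLoss_le (P := P) L π φ) T)
  refine le_limsup_of_le (isBoundedUnder_of ⟨_, fun T => (hb T).2⟩) fun b hb' => ?_
  obtain ⟨T, hT⟩ := hb'.exists
  exact (hb T).1.trans hT

lemma optimalLoss_eq_reducedOptimalLoss [∀ n, Nonempty (𝒴 n)] (L : (n : Fin N) → 𝒴 n → 𝒴 n → ℝ)
    (h : ∀ (π : CausalPolicy M 𝒳) (φ : Estimators 𝒳 𝒴),
      ∃ (ρ : ReducedPolicy M 𝒳) (f : ReducedEstimators 𝒳 𝒴),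
        S.averageLoss P L ρ.toCausal f.toEstimators ≤ S.averageLoss P L π φ) :
    S.optimalLoss M P L = S.reducedOptimalLoss M P L := by
  have : ∀ I : ℕ → Type _, Nonempty (Policy N M I) := fun I =>
    ⟨⟨fun _ _ _ _ => false, fun _ _ => measurable_const, fun _ _ _ => by simp⟩⟩
  have : Nonempty (Estimators 𝒳 𝒴) := ⟨fun _ _ _ => Classical.arbitrary _⟩
  have : Nonempty (ReducedEstimators 𝒳 𝒴) := ⟨fun _ _ _ => Classical.arbitrary _⟩
  refine le_antisymm (le_ciInf fun q => ?_) (le_ciInf fun q => ?_)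
  · refine ciInf_le_of_le ⟨-∑ n, ∑ z : 𝒴 n × 𝒴 n, |L n z.1 z.2|, ?_⟩
      (q.1.toCausal, q.2.toEstimators) le_rfl
    rintro _ ⟨q, rfl⟩
    exact neg_le_averageLoss L q.1 q.2
  · obtain ⟨ρ, f, hρ⟩ := h q.1 q.2
    refine ciInf_le_of_le ⟨-∑ n, ∑ z : 𝒴 n × 𝒴 n, |L n z.1 z.2|, ?_⟩ (ρ, f) hρ
    rintro _ ⟨q, rfl⟩
    exact neg_le_averageLoss L q.1.toCausal q.2.toEstimators

end MonitoringSystem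

theorem theorem1 {N M : ℕ} {𝒳 𝒴 : Fin N → Type*}
    [∀ n, Finite (𝒳 n)] [∀ n, MeasurableSpace (𝒳 n)] [∀ n, MeasurableSingletonClass (𝒳 n)]
    [∀ n, Finite (𝒴 n)] [∀ n, MeasurableSpace (𝒴 n)] [∀ n, MeasurableSingletonClass (𝒴 n)]
    {Ω : Type*} [MeasurableSpace Ω] (P : Measure Ω) [IsProbabilityMeasure P]
    (S : MonitoringSystem N 𝒳 𝒴 Ω) (hS : S.IsModel P) (hA : S.MarkovAssumption P) :
    -- (i) sufficiency for estimation, under every causal policy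
    (∀ (π : CausalPolicy M 𝒳) (n : Fin N) (t : ℕ),
      IsSufficientStatistic P (fun ω => S.jointHistory π ω t n) History.state (S.Y n t)) ∧
    -- (ii) sufficiency for scheduling: given the joint history and the decision, the conditional
    -- laws of the safety levels and of the next state tuple depend only on the current state
    -- tuple and on the decision, through kernels that do not depend on the policy
    (∃ K : (n : Fin N) → ℕ → ℕ × 𝒳 n → 𝒴 n → ℝ,
      ∀ (π : CausalPolicy M 𝒳) (n : Fin N) (t : ℕ) (h : JointHistory 𝒳 t) (a : Fin N → Bool)
        (y : 𝒴 n),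
        P.real {ω | S.jointHistory π ω t = h ∧ S.decision π t ω = a ∧ S.Y n t ω = y} =
          P.real {ω | S.jointHistory π ω t = h ∧ S.decision π t ω = a} *
            K n t (History.state (h n)) y) ∧
    (∃ Q : ℕ → JointState 𝒳 → (Fin N → Bool) → JointState 𝒳 → ℝ,
      ∀ (π : CausalPolicy M 𝒳) (t : ℕ) (h : JointHistory 𝒳 t) (a : Fin N → Bool)
        (s : JointState 𝒳),
        P.real {ω | S.jointHistory π ω t = h ∧ S.decision π t ω = a ∧
            JointHistory.state (S.jointHistory π ω (t + 1)) = s} =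
          P.real {ω | S.jointHistory π ω t = h ∧ S.decision π t ω = a} *
            Q t (JointHistory.state h) a s) ∧
    -- no loss of optimality for any loss functions: over each finite horizon some deterministic
    -- reduced policy with reduced estimators is optimal among all causal policies and estimators
    (∀ (L : (n : Fin N) → 𝒴 n → 𝒴 n → ℝ),
      (∀ T : ℕ, ∃ (ρ : ReducedPolicy M 𝒳) (f : ReducedEstimators 𝒳 𝒴), ρ.IsDeterministic ∧
        ∀ (π : CausalPolicy M 𝒳) (φ : Estimators 𝒳 𝒴),
          ∑ t ∈ Finset.range T, ∑ n, S.expectedLoss P L ρ.toCausal f.toEstimators n t ≤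
            ∑ t ∈ Finset.range T, ∑ n, S.expectedLoss P L π φ n t) ∧
      -- for the average loss, every causal policy and estimators are matched by reduced ones
      (∀ (π : CausalPolicy M 𝒳) (φ : Estimators 𝒳 𝒴),
        ∃ (ρ : ReducedPolicy M 𝒳) (f : ReducedEstimators 𝒳 𝒴),
          S.averageLoss P L ρ.toCausal f.toEstimators ≤ S.averageLoss P L π φ) ∧
      S.optimalLoss M P L = S.reducedOptimalLoss M P L) := by
  classical
  have := fun n => Fintype.ofFinite (𝒳 n)
  have := fun n => Fintype.ofFinite (𝒴 n)
  obtain ⟨ω₀⟩ := nonempty_of_isProbabilityMeasure P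
  have : ∀ n, Nonempty (𝒴 n) := fun n => ⟨S.Y n 0 ω₀⟩
  refine ⟨fun π n t => hS.isSufficientStatistic_state hA π n t,
    ⟨S.levelKernel P, fun π n t h a y => hS.measureReal_decision_and_level hA π t h a n y⟩,
    ⟨fun t s a s' => S.transition P t (fun s'' => if s'' = s' then 1 else 0) s a,
      fun π t h a s => by
        convert hS.measureReal_state_succ hA π t h a s⟩, fun L => ?_⟩
  obtain ⟨f, hf⟩ := S.exists_isBayes P L
  have havg : ∀ (π : CausalPolicy M 𝒳) (φ : Estimators 𝒳 𝒴),
      ∃ (ρ : ReducedPolicy M 𝒳) (f : ReducedEstimators 𝒳 𝒴),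
        S.averageLoss P L ρ.toCausal f.toEstimators ≤ S.averageLoss P L π φ := by
    intro π φ
    obtain ⟨ρ, hρ⟩ := hS.exists_reducedPolicy hA π
    refine ⟨ρ, f, MonitoringSystem.averageLoss_le_averageLoss L fun n t => ?_⟩
    rw [hS.expectedLoss_eq hA]
    exact (hρ t fun s => S.conditionalLoss P L n t (s n) (f n t (s n))).trans_le
      (hS.integral_conditionalLoss_le hA hf π φ n t)
  refine ⟨fun T => ?_, havg, MonitoringSystem.optimalLoss_eq_reducedOptimalLoss L havg⟩
  obtain ⟨ρ, hdet, hρ⟩ := hS.exists_policy_integral_eq_optimalCost (M := M) hA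
    (fun t s => ∑ n, S.conditionalLoss P L n t (s n) (f n t (s n))) T
  have hsum : ∀ (π : CausalPolicy M 𝒳) (t : ℕ),
      ∫ ω, ∑ n, S.conditionalLoss P L n t (JointHistory.state (S.jointHistory π ω t) n)
        (f n t (JointHistory.state (S.jointHistory π ω t) n)) ∂P =
      ∑ n, ∫ ω, S.conditionalLoss P L n t (JointHistory.state (S.jointHistory π ω t) n)
        (f n t (JointHistory.state (S.jointHistory π ω t) n)) ∂P := fun π t =>
    integral_finsetSum _ fun n _ => (hS.finitelyValued_state π t).integrable
      fun s => S.conditionalLoss P L n t (s n) (f n t (s n))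
  refine ⟨ρ, f, hdet, fun π φ => ?_⟩
  have h1 := hρ T 0 (zero_add T)
  have h2 := hS.integral_optimalCost_le hA
    (fun t s => ∑ n, S.conditionalLoss P L n t (s n) (f n t (s n))) π T 0
  simp only [hsum] at h1 h2
  -- Both bounds involve the same optimal cost, as the initial state tuple does not depend on the
  -- policy.
  refine (Eq.trans_le ?_ h2).trans ?_
  · refine Eq.trans ?_ h1
    refine Finset.sum_congr rfl fun t _ => ?_
    rw [zero_add]
    exact Finset.sum_congr rfl fun n _ => hS.expectedLoss_eq hA L _ _ n t
  · refine Finset.sum_le_sum fun t _ => Finset.sum_le_sum fun n _ => ?_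
    rw [zero_add]
    exact hS.integral_conditionalLoss_le hA hf π φ n t
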